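/- Let $I$ be a set, $n_\alpha\ge 1$ $(\alpha\in I)$ integers, $\mathcal A_0=\bigoplus_{\alpha\in I}M_{n_\alpha}(\mathbb C)$ the algebraic direct sum, with matrix units $e^\alpha_{ij}$, and $\mathcal M_{\rm alg}(\mathcal A_0)=\prod_\alpha M_{n_\alpha}(\mathbb C)$, $\mathcal M_{\rm alg}(\mathcal A_0\otimes\mathcal A_0)=\prod_{\alpha,\beta}M_{n_\alpha}(\mathbb C)\otimes M_{n_\beta}(\mathbb C)$. Let $\Delta:\mathcal A_0\to\mathcal M_{\rm alg}(\mathcal A_0\otimes\mathcal A_0)$ be a discrete quantum group: a $*$-homomorphism such that $T_1(a\otimes b)=\Delta(a)(1\otimes b)$ and $T_2(a\otimes b)=(a\otimes1)\Delta(b)$ define bijections of $\mathcal A_0\otimes_{\rm alg}\mathcal A_0$, and $(a\otimes1\otimes1)(\Delta\otimes{\rm id})(\Delta(b)(1\otimes c))=({\rm id}\otimes\Delta)((a\otimes1)\Delta(b))(1\otimes1\otimes c)$ for $a,b,c\in\mathcal A_0$. Let $S$ be its antipode, $\phi$ a positive faithful left invariant functional on $\mathcal A_0$ (that is, $({\rm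 id}\otimes\phi)((b\otimes1)\Delta(a))=\phi(a)b$), let $\theta=(\theta_\alpha)\in\mathcal M_{\rm alg}(\mathcal A_0)$ be the family of positive invertible matrices with $\phi(S(a))=\phi(a\theta^2)$ for all $a\in\mathcal A_0$, and put $\psi(a)=\phi(a\theta^2)$ (a right invariant functional) and $\psi_a(b)=\psi(ab)$. For functionals $f,g$ on $\mathcal A_0$ that vanish on all but finitely many $M_{n_\alpha}(\mathbb C)$ put $(f*g)(x)=(f\otimes g)(\Delta(x))$. The convolution algebra $\hat{\mathcal A}_0$ is $\mathcal A_0$ with the product $a*b=({\rm id}\otimes\phi)(\Delta(a)(1\otimes S(b)))=({\rm id}\otimes\psi)((1\otimes b)({\rm id}\otimes S^{-1})(\Delta(a)))$. Let $\mathcal C$ be a $C^*$-algebra with a dense $*$-subalgebra $\mathcal C_0$ and a coassociative action $\Delta_{\mathcal C}$ of the quantum group on $\mathcal C$, i.e. a $*$-homomorphism from $\mathcal C$ to the families $(x_\alpha)_\alpha$ with $x_\alpha\in\mathcal C\otimes M_{n_\alpha}(\mathbb C)$ such that $(\Delta_{\mathcal C}\otimes{\rm id})\Delta_{\mathcal C}=({\rm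 id}\otimes\Delta)\Delta_{\mathcal C}$, with $\Delta_{\mathcal C}(c)(1\otimes a)\in\mathcal C_0\otimes_{\rm alg}\mathcal A_0$ for $c\in\mathcal C_0$, $a\in\mathcal A_0$. Let $\mathcal H$ be a Hilbert space, $U=\sum_{\alpha,i,j}U^\alpha_{ij}\otimes e^\alpha_{ij}$ a unitary representation of the quantum group on $\mathcal H$, i.e. a family of unitaries in $\mathcal B(\mathcal H)\otimes M_{n_\alpha}(\mathbb C)$, $\alpha\in I$, with $({\rm id}\otimes\Delta)(U)=U_{12}U_{13}$, and $\pi:\mathcal C\to\mathcal B(\mathcal H)$ a nondegenerate $*$-homomorphism with $(\pi\otimes{\rm id})(\Delta_{\mathcal C}(c))=U(\pi(c)\otimes1)U^*$ for all $c\in\mathcal C$. For $\xi\in\mathcal H$ and $a\in\mathcal A_0$ put $$\xi\cdot a=({\rm id}\otimes\psi_{\theta^{-1}S(a)\theta^{-2}})(U)\,\xi=\sum_{\alpha,i,j}\psi(\theta^{-1}S(a)\theta^{-2}e^\alpha_{ij})\,U^\alpha_{ij}\xi .$$ Then $\psi_{a*b}=\psi_a*\psi_b$ for all $a,b\in\mathcal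 A_0$. Moreover, let $\mathcal H_0$ be the linear span $\pi(\mathcal C)\mathcal H$ of the vectors $\pi(c)\eta$ with $c\in\mathcal C$, $\eta\in\mathcal H$, or the linear span $\pi(\mathcal C_0)\mathcal H$ of those with $c\in\mathcal C_0$. In either case $(\xi,a)\mapsto\xi\cdot a$ is a right module action of $\hat{\mathcal A}_0$ on $\mathcal H_0$: it is a bilinear map $\mathcal H_0\times\mathcal A_0\to\mathcal H_0$, and $(\xi\cdot a)\cdot b=\xi\cdot(a*b)$ for all $a,b\in\mathcal A_0$, $\xi\in\mathcal H_0$. -/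

import Mathlib

open scoped TensorProduct Kronecker ComplexOrder

noncomputable section

namespace DQG

/-- All families `(a_α)` with `a_α` in `M_{n α}(ℂ)`: the algebraic multipliers of
`𝒜₀ = ⨁_α M_{n α}(ℂ)`, with pointwise operations. -/
abbrev Mult {I : Type*} (n : I → ℕ) : Type _ :=
  ∀ α, Matrix (Fin (n α)) (Fin (n α)) ℂ

/-- The algebraic multipliers of `𝒜₀ ⊗ 𝒜₀`: families `(m_{αβ})` with `m_{αβ}` in
`M_{n α}(ℂ) ⊗ M_{n β}(ℂ)`. -/
abbrev Mult₂ {I : Type*} (n : I → ℕ) : Type _ :=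
  ∀ α β, Matrix (Fin (n α) × Fin (n β)) (Fin (n α) × Fin (n β)) ℂ

/-- The algebraic direct sum `𝒜₀ = ⨁_α M_{n α}(ℂ)`, as the finitely supported families. -/
def A₀ {I : Type*} (n : I → ℕ) : NonUnitalStarSubalgebra ℂ (Mult n) where
  carrier := {a | {α | a α ≠ 0}.Finite}
  add_mem' {a b} ha hb := (ha.union hb).subset fun α h => by
    by_contra hc
    simp only [Set.mem_union, Set.mem_ofPred_eq, not_or, not_not] at hc
    exact h (by simp [hc.1, hc.2])
  zero_mem' := by simp
  mul_mem' {a b} ha _ := ha.subset fun α h hc => h (by simp [hc])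
  smul_mem' z a ha := ha.subset fun α h hc => h (by simp [hc])
  star_mem' {a} ha := ha.subset fun α h hc => h (by simp [hc])

variable {I : Type*} {n : I → ℕ}

/-- The matrix unit `e^α_{ij}`. -/
def matUnit (n : I → ℕ) (α : I) (i j : Fin (n α)) : A₀ n := by
  classical
  exact ⟨Pi.single α (Matrix.single i j 1), (Set.finite_singleton α).subset fun β h => by
    by_contra hc
    exact h (Pi.single_eq_of_ne hc _)⟩

/-- The element `x a y` of `𝒜₀`, for `a` in `𝒜₀` and algebraic multipliers `x`, `y`. -/
def sandwich (x : Mult n) (a : A₀ n) (y : Mult n) : A₀ n :=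
  ⟨x * (a : Mult n) * y, Set.Finite.subset a.2 fun α h hc => h (by simp [hc])⟩

/-- The elementary tensor `a ⊗ b` of two algebraic multipliers. -/
def kron (n : I → ℕ) : Mult n →ₗ[ℂ] Mult n →ₗ[ℂ] Mult₂ n :=
  LinearMap.mk₂ ℂ (fun a b α β => a α ⊗ₖ b β)
    (fun a a' b => by funext α β; simp [Matrix.add_kronecker])
    (fun z a b => by funext α β; simp [Matrix.smul_kronecker])
    (fun a b b' => by funext α β; simp [Matrix.kronecker_add])
    (fun z a b => by funext α β; simp [Matrix.kronecker_smul])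

/-- The canonical inclusion of the algebraic tensor product `𝒜₀ ⊗ 𝒜₀` in its algebraic
multipliers. -/
def incl (n : I → ℕ) : A₀ n ⊗[ℂ] A₀ n →ₗ[ℂ] Mult₂ n :=
  TensorProduct.lift
    ((kron n).compl₁₂ (A₀ n).toSubmodule.subtype (A₀ n).toSubmodule.subtype)

/-- A discrete quantum group on `𝒜₀ = ⨁_α M_{n α}(ℂ)`. The comultiplication is given on `𝒜₀`;
since `T₁` is onto, it is nondegenerate, so giving it on `𝒜₀` is the same as giving it as a
unital `*`-homomorphism on the bounded families. -/
structure DiscreteQuantumGroup (I : Type*) where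
  /-- the sizes of the blocks -/
  n : I → ℕ
  n_pos : ∀ α, 0 < n α
  /-- the comultiplication -/
  Δ : A₀ n →⋆ₙₐ[ℂ] Mult₂ n
  /-- `T₁ (a ⊗ b) = Δ(a) (1 ⊗ b)`, a bijection of `𝒜₀ ⊗ 𝒜₀` -/
  T₁ : A₀ n ⊗[ℂ] A₀ n ≃ₗ[ℂ] A₀ n ⊗[ℂ] A₀ n
  /-- `T₂ (a ⊗ b) = (a ⊗ 1) Δ(b)`, a bijection of `𝒜₀ ⊗ 𝒜₀` -/
  T₂ : A₀ n ⊗[ℂ] A₀ n ≃ₗ[ℂ] A₀ n ⊗[ℂ] A₀ n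
  T₁_tmul : ∀ a b : A₀ n, incl n (T₁ (a ⊗ₜ[ℂ] b)) = Δ a * kron n 1 b
  T₂_tmul : ∀ a b : A₀ n, incl n (T₂ (a ⊗ₜ[ℂ] b)) = kron n a 1 * Δ b
  /-- Coassociativity
  `(a ⊗ 1 ⊗ 1)(Δ ⊗ id)(Δ(b)(1 ⊗ c)) = (id ⊗ Δ)((a ⊗ 1)Δ(b))(1 ⊗ 1 ⊗ c)`, where
  `(a ⊗ 1 ⊗ 1)(Δ ⊗ id)(x ⊗ y) = T₂ (a ⊗ x) ⊗ y` and
  `(id ⊗ Δ)(x ⊗ y)(1 ⊗ 1 ⊗ c) = x ⊗ T₁ (y ⊗ c)`. -/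
  coassoc : ∀ a b c : A₀ n,
    T₂.toLinearMap.rTensor (A₀ n)
        ((TensorProduct.assoc ℂ (A₀ n) (A₀ n) (A₀ n)).symm (a ⊗ₜ[ℂ] T₁ (b ⊗ₜ[ℂ] c))) =
      (TensorProduct.assoc ℂ (A₀ n) (A₀ n) (A₀ n)).symm
        (T₁.toLinearMap.lTensor (A₀ n)
          (TensorProduct.assoc ℂ (A₀ n) (A₀ n) (A₀ n) (T₂ (a ⊗ₜ[ℂ] b) ⊗ₜ[ℂ] c)))

/-- `id ⊗ f` on `𝒜₀ ⊗ 𝒜₀`. -/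
def idTensor (f : A₀ n →ₗ[ℂ] ℂ) : A₀ n ⊗[ℂ] A₀ n →ₗ[ℂ] A₀ n :=
  (TensorProduct.rid ℂ (A₀ n)).toLinearMap ∘ₗ f.lTensor (A₀ n)

/-- `f ⊗ id` on `𝒜₀ ⊗ 𝒜₀`. -/
def tensorId (f : A₀ n →ₗ[ℂ] ℂ) : A₀ n ⊗[ℂ] A₀ n →ₗ[ℂ] A₀ n :=
  (TensorProduct.lid ℂ (A₀ n)).toLinearMap ∘ₗ f.rTensor (A₀ n)

/-- `(id ⊗ f)(X) = ∑_{α,i,j} f(e^α_{ij}) X^α_{ij}` for a functional `f` on `𝒜₀` of finite support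
and a family `X = ∑_{α,i,j} X^α_{ij} ⊗ e^α_{ij}` with entries in `R`. -/
def slice {R : Type*} [AddCommMonoid R] [Module ℂ R] (f : A₀ n →ₗ[ℂ] ℂ)
    (X : ∀ α, Matrix (Fin (n α)) (Fin (n α)) R) : R :=
  ∑ᶠ α, ∑ i, ∑ j, f (matUnit n α i j) • X α i j

/-- `(f ⊗ g)(Y)` for functionals `f`, `g` of finite support and an algebraic multiplier `Y` of
`𝒜₀ ⊗ 𝒜₀`. -/
def slice₂ (f g : A₀ n →ₗ[ℂ] ℂ) (Y : Mult₂ n) : ℂ :=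
  slice f fun α i j => slice g fun β k l => Y α β (i, k) (j, l)

/-- The functional `f_a(b) = f(a b)`. -/
def twist (f : A₀ n →ₗ[ℂ] ℂ) (a : A₀ n) : A₀ n →ₗ[ℂ] ℂ :=
  f ∘ₗ LinearMap.mulLeft ℂ a

namespace DiscreteQuantumGroup

variable (G : DiscreteQuantumGroup I)

/-- `ε` is a counit: `(ε ⊗ id)(Δ(a)(1 ⊗ b)) = ab` and `(id ⊗ ε)((a ⊗ 1)Δ(b)) = ab`. -/
def IsCounit (ε : A₀ G.n →ₗ[ℂ] ℂ) : Prop :=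
  ∀ a b : A₀ G.n, tensorId ε (G.T₁ (a ⊗ₜ[ℂ] b)) = a * b ∧
    idTensor ε (G.T₂ (a ⊗ₜ[ℂ] b)) = a * b

/-- The counit (it exists and is unique). -/
def counit : A₀ G.n →ₗ[ℂ] ℂ := Classical.epsilon G.IsCounit

/-- `S` is an antipode: `m(S ⊗ id)(Δ(a)(1 ⊗ b)) = ε(a) b` and
`m(id ⊗ S)((a ⊗ 1)Δ(b)) = ε(b) a`, where `m` is the multiplication of `𝒜₀`. -/
def IsAntipode (S : A₀ G.n →ₗ[ℂ] A₀ G.n) : Prop :=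
  ∀ a b : A₀ G.n,
    LinearMap.mul' ℂ (A₀ G.n) (S.rTensor (A₀ G.n) (G.T₁ (a ⊗ₜ[ℂ] b))) = G.counit a • b ∧
    LinearMap.mul' ℂ (A₀ G.n) (S.lTensor (A₀ G.n) (G.T₂ (a ⊗ₜ[ℂ] b))) = G.counit b • a

/-- The antipode (it exists and is unique). -/
def antipode : A₀ G.n →ₗ[ℂ] A₀ G.n := Classical.epsilon G.IsAntipode

/-- A left Haar measure: a positive faithful functional `φ` on `𝒜₀` that is left invariant,
`(id ⊗ φ)((b ⊗ 1)Δ(a)) = φ(a) b`. -/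
structure IsLeftHaar (φ : A₀ G.n →ₗ[ℂ] ℂ) : Prop where
  nonneg : ∀ a, 0 ≤ φ (star a * a)
  faithful : ∀ a, φ (star a * a) = 0 → a = 0
  invariant : ∀ a b, idTensor φ (G.T₂ (b ⊗ₜ[ℂ] a)) = φ a • b

variable (φ : A₀ G.n →ₗ[ℂ] ℂ)

/-- `θ` is a positive invertible square root of the modular element `δ`, the algebraic multiplier
with `φ(S(a)) = φ(a δ)` for all `a` in `𝒜₀`. -/
def IsModularRoot (θ : Mult G.n) : Prop :=
  (∀ α, (θ α).PosDef) ∧ ∀ a, φ (G.antipode a) = φ (sandwich 1 a (θ ^ 2))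

/-- The positive operator `θ = δ^{1/2}` (it exists and is unique for a left Haar measure `φ`). -/
def theta : Mult G.n := Classical.epsilon (G.IsModularRoot φ)

/-- `θ⁻¹`, formed blockwise. -/
def thetaInv : Mult G.n := fun α => (G.theta φ α)⁻¹

/-- The right Haar measure `ψ(a) = φ(a θ²)`. -/
def psi : A₀ G.n →ₗ[ℂ] ℂ where
  toFun a := φ (sandwich 1 a (G.theta φ ^ 2))
  map_add' a b := by
    rw [← map_add]; congr 1; apply Subtype.ext; simp [sandwich, add_mul]
  map_smul' z a := by
    rw [RingHom.id_apply, ← map_smul]; congr 1; apply Subtype.ext; simp [sandwich]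

/-- The product `a ∗ b` of the convolution algebra `𝒜₀^`:
`a ∗ b = (id ⊗ φ)(Δ(a)(1 ⊗ S(b)))`. As `ψ = φ ∘ S` and `S` reverses products, this is
`(id ⊗ ψ)((1 ⊗ b)(id ⊗ S⁻¹)(Δ(a)))`. -/
def conv (a b : A₀ G.n) : A₀ G.n := idTensor φ (G.T₁ (a ⊗ₜ[ℂ] G.antipode b))

/-- The convolution `(f ∗ g)(x) = (f ⊗ g)(Δ(x))` of functionals of finite support. -/
def convFun (f g : A₀ G.n →ₗ[ℂ] ℂ) (x : A₀ G.n) : ℂ := slice₂ f g (G.Δ x)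

/-- `(id ⊗ Δ)(X)` for a family `X = ∑_{γ,p,q} X^γ_{pq} ⊗ e^γ_{pq}` with entries in `R`. For given
`α`, `β` only finitely many `Δ(e^γ_{pq})_{αβ}` are nonzero. -/
def idComul {R : Type*} [AddCommMonoid R] [Module ℂ R]
    (X : ∀ γ, Matrix (Fin (G.n γ)) (Fin (G.n γ)) R) (α β : I) :
    Matrix (Fin (G.n α) × Fin (G.n β)) (Fin (G.n α) × Fin (G.n β)) R :=
  fun r s => ∑ᶠ γ, ∑ p, ∑ q, G.Δ (matUnit G.n γ p q) α β r s • X γ p q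

/-- An action of the quantum group on a `C*`-algebra `C`, with a dense `*`-subalgebra `C₀` such
that `Δ_C(c)(1 ⊗ a)` is in `C₀ ⊗ 𝒜₀` for `c` in `C₀` and `a` in `𝒜₀`. By this condition the
blocks of `Δ_C(c)` in the multiplier algebra of `C ⊗ 𝒜` have their entries in `C`. -/
structure Action (C : Type*) [NonUnitalCStarAlgebra C] where
  /-- the coaction map -/
  ΔC : C →⋆ₙₐ[ℂ] (∀ α, Matrix (Fin (G.n α)) (Fin (G.n α)) C)
  /-- the dense subalgebra -/
  C₀ : NonUnitalStarSubalgebra ℂ C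
  /-- `(Δ_C ⊗ id) Δ_C = (id ⊗ Δ) Δ_C` -/
  coassoc : ∀ c α β i j k l,
    ΔC (ΔC c β k l) α i j = G.idComul (ΔC c) α β (i, k) (j, l)
  dense : Dense (C₀ : Set C)
  entry_mem : ∀ c ∈ C₀, ∀ α i j, ΔC c α i j ∈ C₀

/-- A unitary representation of the quantum group on `H`: a family
`U = ∑_{α,i,j} U^α_{ij} ⊗ e^α_{ij}` of unitary blocks with `(id ⊗ Δ)(U) = U₁₂ U₁₃`. (Such families
are the unitaries of the multiplier algebra of `K(H) ⊗ 𝒜`.) -/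
structure UnitaryRep (H : Type*) [NormedAddCommGroup H] [InnerProductSpace ℂ H]
    [CompleteSpace H] where
  /-- the blocks of the unitary -/
  U : ∀ α, Matrix (Fin (G.n α)) (Fin (G.n α)) (H →L[ℂ] H)
  unitary_mem : ∀ α, U α ∈ unitary (Matrix (Fin (G.n α)) (Fin (G.n α)) (H →L[ℂ] H))
  comul : ∀ α β, G.idComul U α β = Matrix.kroneckerMap (fun S T => S * T) (U α) (U β)

/-- `π` is nondegenerate and `(π ⊗ id)(Δ_C(c)) = U (π(c) ⊗ 1) U*` for all `c`. -/
structure IsCovariant {G : DiscreteQuantumGroup I} {C : Type*} [NonUnitalCStarAlgebra C]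
    {H : Type*} [NormedAddCommGroup H] [InnerProductSpace ℂ H] [CompleteSpace H]
    (𝒞 : G.Action C) (U : G.UnitaryRep H) (π : C →⋆ₙₐ[ℂ] (H →L[ℂ] H)) : Prop where
  nondegenerate : (Submodule.span ℂ {ξ | ∃ c η, ξ = π c η}).topologicalClosure = ⊤
  covariant : ∀ c α, (𝒞.ΔC c α).map π =
    U.U α * Matrix.diagonal (fun _ => π c) * star (U.U α)

/-- `ξ · a = (id ⊗ ψ_{θ⁻¹ S(a) θ⁻²})(U) ξ`. -/
def act {G : DiscreteQuantumGroup I} (φ : A₀ G.n →ₗ[ℂ] ℂ) {H : Type*} [NormedAddCommGroup H]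
    [InnerProductSpace ℂ H] [CompleteSpace H] (U : G.UnitaryRep H) (ξ : H) (a : A₀ G.n) : H :=
  slice (twist (G.psi φ)
    (sandwich (G.thetaInv φ) (G.antipode a) (G.thetaInv φ ^ 2))) U.U ξ

end DiscreteQuantumGroup

/-- The linear span `π(D)H` of the vectors `π(c) η`, with `c` in `D` and `η` in `H`. -/
def spanImage {C : Type*} [NonUnitalCStarAlgebra C] {H : Type*} [NormedAddCommGroup H]
    [InnerProductSpace ℂ H] [CompleteSpace H] (π : C →⋆ₙₐ[ℂ] (H →L[ℂ] H)) (D : Set C) :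
    Submodule ℂ H :=
  Submodule.span ℂ {ξ | ∃ c ∈ D, ∃ η, ξ = π c η}

/-- `act` restricts to a bilinear map `V × A → V` with `(ξ · a) · b = ξ · (a ∗ b)`. -/
structure IsRightModuleAction {A H : Type*} [AddCommGroup A] [Module ℂ A] [AddCommGroup H]
    [Module ℂ H] (mul : A → A → A) (V : Submodule ℂ H) (act : H → A → H) : Prop where
  mem : ∀ ξ ∈ V, ∀ a, act ξ a ∈ V
  add_left : ∀ ξ ∈ V, ∀ η ∈ V, ∀ a, act (ξ + η) a = act ξ a + act η a
  smul_left : ∀ (z : ℂ), ∀ ξ ∈ V, ∀ a, act (z • ξ) a = z • act ξ a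
  add_right : ∀ ξ ∈ V, ∀ a b, act ξ (a + b) = act ξ a + act ξ b
  smul_right : ∀ (z : ℂ), ∀ ξ ∈ V, ∀ a, act ξ (z • a) = z • act ξ a
  act_act : ∀ ξ ∈ V, ∀ a b, act (act ξ a) b = act ξ (mul a b)

end DQG

end

/-!
The action factors through an algebra of functionals. A unitary representation `U` turns the
convolution of finitely supported functionals into composition of operators,
`(id ⊗ f)(U) (id ⊗ g)(U) = (id ⊗ f ∗ g)(U)` (`UnitaryRep.slice_mul_slice`), so the module property
says that `a ↦ ψ_{θ⁻¹ S(a) θ⁻²}` reverses products, as `a ↦ ψ_a` preserves them. Invariance of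
`π(D)H` is the covariance condition `U_{ij} π(c) = ∑ₖ π(Δ_C(c)_{ik}) U_{kj}`.

The counit, the antipode and `θ` are specified by their properties, and have to be constructed.
The Hopf algebraic part happens in `CoveredHopf`, for a nonunital algebra `A` whose comultiplication
is known only through `T₁` and `T₂`; identities in the multiplier algebra become identities in
tensor powers of `A`, after multiplying by an element of `A` in one leg and cancelling it again.
* The counit comes from `m T₁⁻¹` and coassociativity (`exists_isCounit`). It is a character, so it
  lives on a one-dimensional block, whose unit is a cointegral `h`.
* Let `σ` be the modular automorphism of `φ`. Then `S(a) = φ(h)⁻¹ (id ⊗ φ)(Δ(h)(1 ⊗ σ(a)))` is an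
  antipode (`exists_isAntipode`), and strong left invariance `S_lam` gives `S² = σ` (`S_S`).
* The relation `Δ ∘ S = flip (S ⊗ S) Δ` (`T₁_S_tmul_S`) and the adjunction `φ_mul_lam_S` yield both
  statements on convolutions (`ψ_conv_mul`, `φ_conv_mul`).
* If `φ ∘ S = φ(· δ)`, then `(φ ⊗ id)Δ = φ(·) δ`, hence `δ` is group-like (`T₁_modular`).

In the blocks `φ = tr(ρ ·)` with `ρ` positive definite, and `σ = ρ · ρ⁻¹`. Since `S² = σ`, the
density of `φ ∘ S` is `c ρ⁻¹` with a constant `c > 0` in each block, so that `θ` exists and is a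
positive multiple of `ρ⁻¹` (`exists_theta_eq`). Uniqueness of positive square roots passes
group-likeness from `δ = θ²` to `θ` (`Δ_theta`). Finally `ψ_{θ⁻¹ S(a) θ⁻²}(x) = φ(S⁻¹(a) θ⁻¹ x)`
(`twist_psi_eq`), which reduces the claim on this family to the functionals `φ(S⁻¹(a) ·)`.
-/

/-! ### Comultiplications given by covered products -/

noncomputable section

namespace CoveredHopf

open TensorProduct LinearMap

section Slices

variable {K A : Type*} [Field K] [NonUnitalRing A] [Module K A]

/-- `id ⊗ f` on `A ⊗ A`. -/
def sliceR (f : A →ₗ[K] K) : A ⊗[K] A →ₗ[K] A :=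
  (TensorProduct.rid K A).toLinearMap ∘ₗ f.lTensor A

/-- `f ⊗ id` on `A ⊗ A`. -/
def sliceL (f : A →ₗ[K] K) : A ⊗[K] A →ₗ[K] A :=
  (TensorProduct.lid K A).toLinearMap ∘ₗ f.rTensor A

@[simp] lemma sliceR_tmul (f : A →ₗ[K] K) (a b : A) : sliceR f (a ⊗ₜ[K] b) = f b • a := by
  simp [sliceR]

@[simp] lemma sliceL_tmul (f : A →ₗ[K] K) (a b : A) : sliceL f (a ⊗ₜ[K] b) = f a • b := by
  simp [sliceL]

/-- Slicing both legs, in either order. -/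
lemma apply_sliceR (f g : A →ₗ[K] K) (z : A ⊗[K] A) : f (sliceR g z) = g (sliceL f z) := by
  induction z with
  | zero => simp
  | tmul a b => simp [mul_comm]
  | add x y hx hy => simp [hx, hy]

lemma sliceR_lTensor (f : A →ₗ[K] K) (g : A →ₗ[K] A) (z : A ⊗[K] A) :
    sliceR f (g.lTensor A z) = sliceR (f ∘ₗ g) z := by
  induction z with
  | zero => simp
  | tmul a b => simp
  | add x y hx hy => simp [hx, hy]

lemma sliceR_rTensor (f : A →ₗ[K] K) (g : A →ₗ[K] A) (z : A ⊗[K] A) :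
    sliceR f (g.rTensor A z) = g (sliceR f z) := by
  induction z with
  | zero => simp
  | tmul a b => simp
  | add x y hx hy => simp [hx, hy]

lemma sliceL_lTensor (f : A →ₗ[K] K) (g : A →ₗ[K] A) (z : A ⊗[K] A) :
    sliceL f (g.lTensor A z) = g (sliceL f z) := by
  induction z with
  | zero => simp
  | tmul a b => simp
  | add x y hx hy => simp [hx, hy]

lemma sliceR_map_comm (f : A →ₗ[K] K) (S : A →ₗ[K] A) (z : A ⊗[K] A) :
    sliceR f (TensorProduct.map S S (TensorProduct.comm K A A z)) = S (sliceL (f ∘ₗ S) z) := by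
  induction z with
  | zero => simp
  | tmul a b => simp
  | add x y hx hy => simp [hx, hy]

end Slices

variable (K A : Type*) [Field K] [NonUnitalRing A] [Module K A] [IsScalarTower K A A]
  [SMulCommClass K A A]

variable {K A} in
/-- For `T = T₁`, left multiplication by `Δ(p)` on `A ⊗ A`. -/
def comulL (T : A ⊗[K] A →ₗ[K] A ⊗[K] A) (p : A) : A ⊗[K] A →ₗ[K] A ⊗[K] A :=
  TensorProduct.lift
    ((LinearMap.rTensorHom A ∘ₗ (LinearMap.mul K A).flip).compl₂ (T ∘ₗ TensorProduct.mk K A A p))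

variable {K A} in
/-- For `T = T₂`, right multiplication by `Δ(x)` on `A ⊗ A`. -/
def comulR (T : A ⊗[K] A →ₗ[K] A ⊗[K] A) (x : A) : A ⊗[K] A →ₗ[K] A ⊗[K] A :=
  TensorProduct.lift ((LinearMap.lTensorHom A ∘ₗ LinearMap.mul K A).compl₂
    (T ∘ₗ (TensorProduct.mk K A A).flip x)).flip

variable {K A} in
@[simp] lemma comulL_tmul (T : A ⊗[K] A →ₗ[K] A ⊗[K] A) (p x y : A) :
    comulL T p (x ⊗ₜ y) = (mulRight K x).rTensor A (T (p ⊗ₜ y)) := rfl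

variable {K A} in
@[simp] lemma comulR_tmul (T : A ⊗[K] A →ₗ[K] A ⊗[K] A) (x c a : A) :
    comulR T x (c ⊗ₜ a) = (mulLeft K a).lTensor A (T (c ⊗ₜ x)) := rfl

/-- A comultiplication `Δ` on a nonunital algebra with local units, recorded through the two
bijections `T₁ (a ⊗ b) = Δ(a) (1 ⊗ b)` and `T₂ (a ⊗ b) = (a ⊗ 1) Δ(b)` of `A ⊗ A`. No multiplier
algebra appears: associativity and multiplicativity of `Δ` are expressed by the compatibilities
of `T₁` and `T₂` with each other and with the product. -/
structure CoveredComul where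
  /-- `a ⊗ b ↦ Δ(a) (1 ⊗ b)` -/
  T₁ : A ⊗[K] A ≃ₗ[K] A ⊗[K] A
  /-- `a ⊗ b ↦ (a ⊗ 1) Δ(b)` -/
  T₂ : A ⊗[K] A ≃ₗ[K] A ⊗[K] A
  /-- `(c ⊗ 1) (Δ(x) (1 ⊗ y)) = ((c ⊗ 1) Δ(x)) (1 ⊗ y)` -/
  bridge : ∀ c x y : A, (mulLeft K c).rTensor A (T₁ (x ⊗ₜ y)) =
    (mulRight K y).lTensor A (T₂ (c ⊗ₜ x))
  /-- `Δ(p r) (1 ⊗ s) = Δ(p) (Δ(r) (1 ⊗ s))` -/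
  T₁_mul : ∀ p r s : A, T₁ ((p * r) ⊗ₜ s) = comulL T₁.toLinearMap p (T₁ (r ⊗ₜ s))
  /-- `(p ⊗ 1) Δ(q x) = ((p ⊗ 1) Δ(q)) Δ(x)` -/
  T₂_mul : ∀ p q x : A, T₂ (p ⊗ₜ (q * x)) = comulR T₂.toLinearMap x (T₂ (p ⊗ₜ q))
  coassoc : ∀ a b c : A,
    T₂.toLinearMap.rTensor A ((TensorProduct.assoc K A A A).symm (a ⊗ₜ[K] T₁ (b ⊗ₜ[K] c))) =
      (TensorProduct.assoc K A A A).symm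
        (T₁.toLinearMap.lTensor A (TensorProduct.assoc K A A A (T₂ (a ⊗ₜ[K] b) ⊗ₜ[K] c)))
  local_units : ∀ s : Finset A, ∃ e : A, ∀ a ∈ s, e * a = a ∧ a * e = a

namespace CoveredComul

variable {K A} (D : CoveredComul K A)

lemma exists_unit_left (D : CoveredComul K A) {M : Type*} [AddCommGroup M] [Module K M]
    (z : A ⊗[K] M) :
    ∃ e, (mulLeft K e).rTensor M z = z := by
  classical
  suffices h : ∃ s : Finset A, ∀ e, (∀ a ∈ s, e * a = a) → (mulLeft K e).rTensor M z = z by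
    obtain ⟨s, hs⟩ := h
    obtain ⟨e, he⟩ := D.local_units s
    exact ⟨e, hs e fun a ha => (he a ha).1⟩
  induction z with
  | zero => exact ⟨∅, by simp⟩
  | tmul a b => exact ⟨{a}, fun e he => by simp [he a (by simp)]⟩
  | add x y hx hy =>
    obtain ⟨s, hs⟩ := hx
    obtain ⟨t, ht⟩ := hy
    refine ⟨s ∪ t, fun e he => ?_⟩
    rw [map_add, hs e fun a ha => he a (by simp [ha]), ht e fun a ha => he a (by simp [ha])]

lemma exists_unit_right (D : CoveredComul K A) (z : A ⊗[K] A) :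
    ∃ e, (mulRight K e).lTensor A z = z := by
  classical
  suffices h : ∃ s : Finset A, ∀ e, (∀ a ∈ s, a * e = a) → (mulRight K e).lTensor A z = z by
    obtain ⟨s, hs⟩ := h
    obtain ⟨e, he⟩ := D.local_units s
    exact ⟨e, hs e fun a ha => (he a ha).2⟩
  induction z with
  | zero => exact ⟨∅, by simp⟩
  | tmul a b => exact ⟨{b}, fun e he => by simp [he b (by simp)]⟩
  | add x y hx hy =>
    obtain ⟨s, hs⟩ := hx
    obtain ⟨t, ht⟩ := hy
    refine ⟨s ∪ t, fun e he => ?_⟩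
    rw [map_add, hs e fun a ha => he a (by simp [ha]), ht e fun a ha => he a (by simp [ha])]

lemma tensor_ext_left (D : CoveredComul K A) {M : Type*} [AddCommGroup M] [Module K M]
    {z w : A ⊗[K] M}
    (h : ∀ c, (mulLeft K c).rTensor M z = (mulLeft K c).rTensor M w) : z = w := by
  obtain ⟨e, he⟩ := D.exists_unit_left (z - w)
  rw [map_sub, h, sub_self] at he
  exact sub_eq_zero.1 he.symm

lemma tensor_ext_right (D : CoveredComul K A) {z w : A ⊗[K] A}
    (h : ∀ c, (mulRight K c).lTensor A z = (mulRight K c).lTensor A w) : z = w := by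
  obtain ⟨e, he⟩ := D.exists_unit_right (z - w)
  rw [map_sub, h, sub_self] at he
  exact sub_eq_zero.1 he.symm

lemma ext_left (D : CoveredComul K A) {a b : A} (h : ∀ c, c * a = c * b) : a = b := by
  obtain ⟨e, he⟩ := D.local_units {a - b}
  have := (he (a - b) (by simp)).1
  rw [mul_sub, h, sub_self] at this
  exact sub_eq_zero.1 this.symm

lemma ext_right (D : CoveredComul K A) {a b : A} (h : ∀ c, a * c = b * c) : a = b := by
  obtain ⟨e, he⟩ := D.local_units {a - b}
  have := (he (a - b) (by simp)).2
  rw [sub_mul, h, sub_self] at this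
  exact sub_eq_zero.1 this.symm

/-- Coassociativity with `Δ(b)(1 ⊗ c)` replaced by `T₁ z`. -/
lemma coassoc' (a : A) (z : A ⊗[K] A) :
    D.T₂.toLinearMap.rTensor A ((TensorProduct.assoc K A A A).symm (a ⊗ₜ[K] D.T₁ z)) =
      (TensorProduct.assoc K A A A).symm (D.T₁.toLinearMap.lTensor A
        (TensorProduct.assoc K A A A
          (D.T₂.toLinearMap.rTensor A ((TensorProduct.assoc K A A A).symm (a ⊗ₜ[K] z))))) := by
  induction z with
  | zero => simp
  | tmul b c => simpa using D.coassoc a b c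
  | add x y hx hy => simp only [map_add, tmul_add, hx, hy]

/-- As operators on `A ⊗ A ⊗ A`, `T₂ ⊗ id` commutes with `id ⊗ T₁⁻¹`. -/
lemma coassoc_symm (a x y : A) :
    D.T₁.symm.toLinearMap.lTensor A (TensorProduct.assoc K A A A (D.T₂ (a ⊗ₜ[K] x) ⊗ₜ[K] y)) =
      TensorProduct.assoc K A A A (D.T₂.toLinearMap.rTensor A
        ((TensorProduct.assoc K A A A).symm (a ⊗ₜ[K] D.T₁.symm (x ⊗ₜ[K] y)))) := by
  have h := D.coassoc' a (D.T₁.symm (x ⊗ₜ[K] y))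
  simp only [LinearEquiv.apply_symm_apply, assoc_symm_tmul, rTensor_tmul,
    LinearEquiv.coe_coe] at h
  rw [h, LinearEquiv.apply_symm_apply, ← LinearMap.lTensor_comp_apply]
  simp

/-- `(id ⊗ m)(T₂ ⊗ id)(a ⊗ z) = (a ⊗ 1) T₁ z`. -/
lemma lTensor_mul_T₂ (a : A) (z : A ⊗[K] A) :
    (mul' K A).lTensor A (TensorProduct.assoc K A A A
      (D.T₂.toLinearMap.rTensor A ((TensorProduct.assoc K A A A).symm (a ⊗ₜ[K] z)))) =
      (mulLeft K a).rTensor A (D.T₁ z) := by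
  induction z with
  | zero => simp
  | tmul p q =>
    rw [D.bridge]
    simp only [assoc_symm_tmul, rTensor_tmul, LinearEquiv.coe_coe]
    induction D.T₂ (a ⊗ₜ[K] p) with
    | zero => simp
    | tmul u v => simp
    | add x y hx hy => simp only [map_add, add_tmul, hx, hy]
  | add x y hx hy => simp only [map_add, tmul_add, hx, hy]

/-- A counit for `D`. -/
def IsCounit (ε : A →ₗ[K] K) : Prop :=
  ∀ a b : A, sliceL ε (D.T₁ (a ⊗ₜ[K] b)) = a * b ∧ sliceR ε (D.T₂ (a ⊗ₜ[K] b)) = a * b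

/-- An antipode for `D`, relative to the counit `ε`. -/
def IsAntipode (ε : A →ₗ[K] K) (S : A →ₗ[K] A) : Prop :=
  ∀ a b : A, mul' K A (S.rTensor A (D.T₁ (a ⊗ₜ[K] b))) = ε a • b ∧
    mul' K A (S.lTensor A (D.T₂ (a ⊗ₜ[K] b))) = ε b • a

/-- Both `m T₁⁻¹` and `m T₂⁻¹` are determined by one functional: coassociativity gives
`(id ⊗ m T₁⁻¹)(T₂ ⊗ id) = m ⊗ id`, so `a ⊗ m T₁⁻¹(x ⊗ y) = m T₂⁻¹(a ⊗ x) ⊗ y`, and this forces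
the two sides to be `a ⊗ ε(x) y`. -/
theorem exists_isCounit : ∃ ε, D.IsCounit ε := by
  by_cases hA : Subsingleton A
  · exact ⟨0, fun a b => ⟨Subsingleton.elim _ _, Subsingleton.elim _ _⟩⟩
  obtain ⟨a₀, ha₀⟩ : ∃ a : A, a ≠ 0 := by
    have := not_subsingleton_iff_nontrivial.1 hA
    exact exists_ne 0
  obtain ⟨ω, hω⟩ : ∃ ω : A →ₗ[K] K, ω a₀ = 1 := by
    have h := (Module.forall_dual_apply_eq_zero_iff K a₀).not.2 ha₀
    push Not at h
    obtain ⟨f, hf⟩ := h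
    exact ⟨(f a₀)⁻¹ • f, by simp [hf]⟩
  have claim : ∀ (w : A ⊗[K] A) (y : A),
      (mul' K A ∘ₗ D.T₁.symm.toLinearMap).lTensor A (TensorProduct.assoc K A A A (D.T₂ w ⊗ₜ y)) =
        mul' K A w ⊗ₜ y := by
    intro w y
    induction w with
    | zero => simp
    | tmul a x =>
      rw [LinearMap.lTensor_comp_apply, D.coassoc_symm, D.lTensor_mul_T₂]
      simp
    | add u v hu hv => simp only [map_add, add_tmul, hu, hv]
  have key : ∀ a x y : A, a ⊗ₜ[K] (mul' K A (D.T₁.symm (x ⊗ₜ y))) =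
      mul' K A (D.T₂.symm (a ⊗ₜ x)) ⊗ₜ[K] y := by
    intro a x y
    have := claim (D.T₂.symm (a ⊗ₜ x)) y
    simpa using this
  let ε : A →ₗ[K] K := ω ∘ₗ mul' K A ∘ₗ D.T₂.symm.toLinearMap ∘ₗ TensorProduct.mk K A A a₀
  have h1 : ∀ x y, mul' K A (D.T₁.symm (x ⊗ₜ y)) = ε x • y := by
    intro x y
    have := congrArg (sliceL ω) (key a₀ x y)
    simpa [hω, ε] using this
  have h2 : ∀ a x, mul' K A (D.T₂.symm (a ⊗ₜ x)) = ε x • a := by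
    intro a x
    have := congrArg (sliceR ω) (key a x a₀)
    simpa [hω, h1] using this.symm
  have h1' : ∀ z, mul' K A (D.T₁.symm z) = sliceL ε z := by
    intro z
    induction z with
    | zero => simp
    | tmul x y => simp [h1]
    | add u v hu hv => simp only [map_add, hu, hv]
  have h2' : ∀ z, mul' K A (D.T₂.symm z) = sliceR ε z := by
    intro z
    induction z with
    | zero => simp
    | tmul x y => simp [h2]
    | add u v hu hv => simp only [map_add, hu, hv]
  exact ⟨ε, fun a b => ⟨by rw [← h1']; simp, by rw [← h2']; simp⟩⟩

section Counit

variable {D} {ε : A →ₗ[K] K}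

lemma IsCounit.sliceL_T₁ (hε : D.IsCounit ε) (z : A ⊗[K] A) :
    sliceL ε (D.T₁ z) = mul' K A z := by
  induction z with
  | zero => simp
  | tmul x y => simp [(hε x y).1]
  | add u v hu hv => simp only [map_add, hu, hv]

lemma IsCounit.sliceR_T₂ (hε : D.IsCounit ε) (z : A ⊗[K] A) :
    sliceR ε (D.T₂ z) = mul' K A z := by
  induction z with
  | zero => simp
  | tmul x y => simp [(hε x y).2]
  | add u v hu hv => simp only [map_add, hu, hv]

/-- `(ε ⊗ id)(Δ(a) z) = a (ε ⊗ id)(z)`. -/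
lemma IsCounit.sliceL_comulL (hε : D.IsCounit ε) (a : A) (z : A ⊗[K] A) :
    sliceL ε (comulL D.T₁.toLinearMap a z) = a * sliceL ε z := by
  obtain ⟨w, rfl⟩ := D.T₁.surjective z
  induction w with
  | zero => simp
  | tmul x y => rw [← D.T₁_mul, (hε _ _).1, (hε _ _).1, mul_assoc]
  | add u v hu hv => simp only [map_add, hu, hv, mul_add]

lemma IsCounit.map_mul (hε : D.IsCounit ε) (p x : A) : ε (p * x) = ε p * ε x := by
  by_cases hA : Subsingleton A
  · simp [Subsingleton.elim p 0]
  obtain ⟨y, hy⟩ : ∃ a : A, a ≠ 0 := by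
    have := not_subsingleton_iff_nontrivial.1 hA
    exact exists_ne 0
  have claim : ∀ w, sliceL ε ((mulRight K x).rTensor A (D.T₁ w)) = ε x • mul' K A w := by
    intro w
    induction w with
    | zero => simp
    | tmul a b =>
      have := hε.sliceL_comulL a (x ⊗ₜ b)
      simpa [mul_smul_comm] using this
    | add u v hu hv => simp only [map_add, hu, hv, smul_add]
  have h := claim (D.T₁.symm (p ⊗ₜ y))
  rw [← hε.sliceL_T₁] at h
  simp only [LinearEquiv.apply_symm_apply, rTensor_tmul, mulRight_apply, sliceL_tmul,
    smul_smul] at h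
  rw [mul_comm (ε p)]
  exact smul_left_injective K hy h

/-- The second antipode axiom implies the first: both `S(a) b` and `(ε ⊗ id) T₁⁻¹(a ⊗ b)` become
equal after left multiplication by any `c`. -/
lemma isAntipode_of_right (hε : D.IsCounit ε) {S : A →ₗ[K] A}
    (hS : ∀ a b : A, mul' K A (S.lTensor A (D.T₂ (a ⊗ₜ[K] b))) = ε b • a) :
    D.IsAntipode ε S := by
  have step : ∀ (p : A) (z : A ⊗[K] A), mul' K A ((sliceL ε).lTensor A
      (TensorProduct.assoc K A A A (D.T₂.toLinearMap.rTensor A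
        ((TensorProduct.assoc K A A A).symm (p ⊗ₜ[K] z))))) = p * mul' K A z := by
    intro p z
    induction z with
    | zero => simp
    | tmul s r =>
      have h := hε.sliceR_T₂ (p ⊗ₜ s)
      simp only [mul'_apply] at h
      simp only [assoc_symm_tmul, rTensor_tmul, LinearEquiv.coe_coe, mul'_apply]
      rw [← mul_assoc, ← h]
      induction D.T₂ (p ⊗ₜ[K] s) with
      | zero => simp
      | tmul u v => simp [smul_mul_assoc]
      | add x y hx hy => simp only [map_add, add_tmul, hx, hy, add_mul]
    | add u v hu hv => simp only [map_add, tmul_add, hu, hv, mul_add]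
  have hT₁ : ∀ q b, mul' K A (D.T₁.symm (q ⊗ₜ b)) = ε q • b := by
    intro q b
    rw [← hε.sliceL_T₁]
    simp
  have main : ∀ (z : A ⊗[K] A) (b : A), mul' K A ((sliceL ε ∘ₗ D.T₁.symm.toLinearMap).lTensor A
      (TensorProduct.assoc K A A A (z ⊗ₜ b))) = mul' K A (S.lTensor A z) * b := by
    intro z b
    obtain ⟨w, rfl⟩ := D.T₂.surjective z
    induction w with
    | zero => simp
    | tmul p q =>
      rw [LinearMap.lTensor_comp_apply, D.coassoc_symm, step, hT₁, hS, mul_smul_comm,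
        smul_mul_assoc]
    | add u v hu hv => simp only [map_add, add_tmul, hu, hv, add_mul]
  have h1 : ∀ a b, S a * b = sliceL ε (D.T₁.symm (a ⊗ₜ b)) := by
    intro a b
    refine D.ext_left fun c => ?_
    have := main (c ⊗ₜ a) b
    simpa [mul_assoc] using this.symm
  have h2 : ∀ z, mul' K A (S.rTensor A z) = sliceL ε (D.T₁.symm z) := by
    intro z
    induction z with
    | zero => simp
    | tmul a b => simp [h1]
    | add u v hu hv => simp only [map_add, hu, hv]
  exact fun a b => ⟨by rw [h2]; simp, hS a b⟩

lemma IsAntipode.eq {S S' : A →ₗ[K] A} (hS : D.IsAntipode ε S) (hS' : D.IsAntipode ε S') :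
    S = S' := by
  have h : ∀ z, mul' K A (S.lTensor A z) = mul' K A (S'.lTensor A z) := by
    intro z
    obtain ⟨w, rfl⟩ := D.T₂.surjective z
    induction w with
    | zero => simp
    | tmul p q => rw [(hS p q).2, (hS' p q).2]
    | add u v hu hv => simp only [map_add, hu, hv]
  ext a
  exact D.ext_left fun c => by simpa using h (c ⊗ₜ a)

/-- The antipode reverses products. -/
lemma IsAntipode.map_mul (hε : D.IsCounit ε) {S : A →ₗ[K] A} (hS : D.IsAntipode ε S) (a b : A) :
    S (a * b) = S b * S a := by
  have c2 : ∀ p z, mul' K A (S.rTensor A (comulL D.T₁.toLinearMap p z)) =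
      ε p • mul' K A (S.rTensor A z) := by
    intro p z
    obtain ⟨w, rfl⟩ := D.T₁.surjective z
    induction w with
    | zero => simp
    | tmul r s => rw [← D.T₁_mul, (hS _ _).1, (hS _ _).1, hε.map_mul, smul_smul]
    | add u v hu hv => simp only [map_add, hu, hv, smul_add]
  have c1 : ∀ w, mul' K A (S.rTensor A ((mulRight K b).rTensor A (D.T₁ w))) =
      S b * mul' K A (S.rTensor A (D.T₁ w)) := by
    intro w
    induction w with
    | zero => simp
    | tmul p q =>
      have := c2 p (b ⊗ₜ q)
      rw [(hS _ _).1]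
      simpa [mul_smul_comm] using this
    | add u v hu hv => simp only [map_add, hu, hv, mul_add]
  refine D.ext_right fun c => ?_
  have := c1 (D.T₁.symm (a ⊗ₜ c))
  simpa [mul_assoc] using this

end Counit

end CoveredComul

end CoveredHopf
end

/-! ### Integrals, the antipode and the modular element -/

noncomputable section

namespace CoveredHopf

open TensorProduct LinearMap

variable {K A : Type*} [Field K] [NonUnitalRing A] [Module K A] [IsScalarTower K A A]
  [SMulCommClass K A A]

/-- A left invariant functional `φ` that is faithful and has a modular automorphism `σ`, together
with the counit `ε` and a two-sided cointegral `h` that `φ` does not kill. -/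
structure HaarData (D : CoveredComul K A) where
  /-- the left invariant functional -/
  φ : A →ₗ[K] K
  /-- the modular automorphism, `φ(ab) = φ(b σ(a))` -/
  σ : A ≃ₗ[K] A
  /-- the counit -/
  ε : A →ₗ[K] K
  /-- the cointegral -/
  h : A
  isCounit : D.IsCounit ε
  left_invariant : ∀ a b, sliceR φ (D.T₂ (b ⊗ₜ[K] a)) = φ a • b
  modular : ∀ a b, φ (a * b) = φ (b * σ a)
  faithful : ∀ a, (∀ b, φ (b * a) = 0) → a = 0
  mul_h : ∀ a, a * h = ε a • h
  h_mul : ∀ a, h * a = ε a • h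
  φ_h : φ h ≠ 0

namespace HaarData

variable {D : CoveredComul K A} (X : HaarData D)

/-- `(id ⊗ φ)(Δ(a)(1 ⊗ x))`. -/
def lam (a x : A) : A := sliceR X.φ (D.T₁ (a ⊗ₜ[K] x))

/-- `lam` as a linear map in its first variable. -/
def lamL (x : A) : A →ₗ[K] A :=
  sliceR X.φ ∘ₗ D.T₁.toLinearMap ∘ₗ (TensorProduct.mk K A A).flip x

@[simp] lemma lamL_apply (x a : A) : X.lamL x a = X.lam a x := rfl

/-- `lam` as a linear map in its second variable. -/
def lamR (a : A) : A →ₗ[K] A :=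
  sliceR X.φ ∘ₗ D.T₁.toLinearMap ∘ₗ TensorProduct.mk K A A a

@[simp] lemma lamR_apply (a x : A) : X.lamR a x = X.lam a x := rfl

lemma mul_lam (c a x : A) :
    c * X.lam a x = sliceR X.φ ((mulRight K x).lTensor A (D.T₂ (c ⊗ₜ a))) := by
  rw [← D.bridge, sliceR_rTensor]
  rfl

/-- `c · lam x (σ a) = (id ⊗ φ)((c ⊗ a) Δ(x))`. -/
lemma mul_lam_σ (c a x : A) :
    c * X.lam x (X.σ a) = sliceR X.φ ((mulLeft K a).lTensor A (D.T₂ (c ⊗ₜ x))) := by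
  rw [mul_lam, sliceR_lTensor, sliceR_lTensor]
  congr 2
  ext b
  exact (X.modular a b).symm

/-- `(id ⊗ lam(·, x)) T₂ (p ⊗ q) = T₂ (p ⊗ lam q x)`. -/
lemma lTensor_lamL_T₂ (p q x : A) :
    (X.lamL x).lTensor A (D.T₂ (p ⊗ₜ q)) = D.T₂ (p ⊗ₜ X.lam q x) := by
  have h1 : ∀ z : A ⊗[K] A, (X.lamL x).lTensor A z =
      (sliceR X.φ).lTensor A (D.T₁.toLinearMap.lTensor A
        (TensorProduct.assoc K A A A (z ⊗ₜ x))) := by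
    intro z
    induction z with
    | zero => simp
    | tmul u v => simp [lam]
    | add u v hu hv => simp only [map_add, add_tmul, hu, hv]
  have h2 : ∀ z : A ⊗[K] A, (sliceR X.φ).lTensor A (TensorProduct.assoc K A A A
      (D.T₂.toLinearMap.rTensor A ((TensorProduct.assoc K A A A).symm (p ⊗ₜ[K] z)))) =
      D.T₂ (p ⊗ₜ sliceR X.φ z) := by
    intro z
    induction z with
    | zero => simp
    | tmul u v =>
      simp only [assoc_symm_tmul, rTensor_tmul, LinearEquiv.coe_coe, sliceR_tmul, tmul_smul,
        map_smul]
      induction D.T₂ (p ⊗ₜ[K] u) with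
      | zero => simp
      | tmul s t => simp
      | add x y hx hy => simp only [map_add, add_tmul, hx, hy, smul_add]
    | add u v hu hv => simp only [map_add, tmul_add, hu, hv]
  rw [h1, lam, ← h2, D.coassoc, LinearEquiv.apply_symm_apply]

/-- `∑ c · lam x (σ a)` over `T₂ (p ⊗ q) = ∑ c ⊗ a` collapses to `φ(q x) p`, by left
invariance. -/
lemma mul_lamR_σ_T₂ (p q x : A) :
    mul' K A ((X.lamR x ∘ₗ X.σ.toLinearMap).lTensor A (D.T₂ (p ⊗ₜ q))) = X.φ (q * x) • p := by
  have h1 : ∀ z, mul' K A ((X.lamR x ∘ₗ X.σ.toLinearMap).lTensor A z) =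
      sliceR X.φ (comulR D.T₂.toLinearMap x z) := by
    intro z
    induction z with
    | zero => simp
    | tmul c a => simpa using X.mul_lam_σ c a x
    | add u v hu hv => simp only [map_add, hu, hv]
  rw [h1, ← D.T₂_mul, X.left_invariant]

lemma exists_isAntipode : ∃ S, D.IsAntipode X.ε S := by
  refine ⟨(X.φ X.h)⁻¹ • (X.lamR X.h ∘ₗ X.σ.toLinearMap),
    CoveredComul.isAntipode_of_right X.isCounit fun a b => ?_⟩
  rw [LinearMap.lTensor_smul, LinearMap.smul_apply, map_smul, mul_lamR_σ_T₂, X.mul_h, map_smul,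
    smul_smul, smul_eq_mul, mul_comm (X.ε b), inv_mul_cancel_left₀ X.φ_h]

/-- The antipode. -/
def S : A →ₗ[K] A := X.exists_isAntipode.choose

lemma isAntipode : D.IsAntipode X.ε X.S := X.exists_isAntipode.choose_spec

lemma S_mul (a b : A) : X.S (a * b) = X.S b * X.S a := X.isAntipode.map_mul X.isCounit a b

/-- Strong left invariance: `S((id ⊗ φ)(Δ(a)(1 ⊗ x))) = (id ⊗ φ)((1 ⊗ a)Δ(x))`. -/
lemma S_lam (a x : A) : X.S (X.lam a x) = X.lam x (X.σ a) := by
  have h : ∀ z, mul' K A ((X.S ∘ₗ X.lamL x).lTensor A z) =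
      mul' K A ((X.lamR x ∘ₗ X.σ.toLinearMap).lTensor A z) := by
    intro z
    obtain ⟨w, rfl⟩ := D.T₂.surjective z
    induction w with
    | zero => simp
    | tmul p q =>
      rw [mul_lamR_σ_T₂, LinearMap.lTensor_comp_apply, lTensor_lamL_T₂, (X.isAntipode _ _).2, lam,
        apply_sliceR, (X.isCounit _ _).1]
    | add u v hu hv => simp only [map_add, hu, hv]
  exact D.ext_left fun c => by simpa using h (c ⊗ₜ a)

lemma T₁_tmul_h (a : A) : D.T₁ (a ⊗ₜ X.h) = a ⊗ₜ X.h := by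
  have h : ∀ z : A ⊗[K] A, (mulRight K X.h).lTensor A z = sliceR X.ε z ⊗ₜ X.h := by
    intro z
    induction z with
    | zero => simp
    | tmul u v => simp [X.mul_h, smul_tmul]
    | add u v hu hv => simp only [map_add, add_tmul, hu, hv]
  refine D.tensor_ext_left fun c => ?_
  rw [D.bridge, h, (X.isCounit _ _).2]
  simp

lemma lam_h (a : A) : X.lam a X.h = X.φ X.h • a := by simp [lam, T₁_tmul_h]

lemma σ_h : X.σ X.h = X.h := by
  refine sub_eq_zero.1 (X.faithful _ fun b => ?_)
  rw [mul_sub, map_sub, ← X.modular, X.mul_h, X.h_mul, sub_self]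

/-- `S(a) = φ(h)⁻¹ (id ⊗ φ)((1 ⊗ a)Δ(h))`. -/
lemma lam_h_σ (a : A) : X.lam X.h (X.σ a) = X.φ X.h • X.S a := by
  rw [← S_lam, lam_h, map_smul]

/-- The square of the antipode is the modular automorphism. -/
theorem S_S (a : A) : X.S (X.S a) = X.σ a := by
  refine smul_right_injective A X.φ_h ?_
  simp only
  rw [← map_smul, ← lam_h_σ, S_lam, σ_h, lam_h]

lemma S_injective : Function.Injective X.S := fun a b h =>
  X.σ.injective (by rw [← S_S, ← S_S, h])

lemma S_surjective : Function.Surjective X.S := fun a =>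
  ⟨X.S (X.σ.symm a), by rw [S_S, LinearEquiv.apply_symm_apply]⟩

lemma φ_σ_mul (a b : A) : X.φ (X.σ (a * b)) = X.φ (a * b) := by
  rw [← S_S, S_mul, S_mul, S_S, S_S, ← X.modular, ← X.modular]

/-- `Δ(S(a))(1 ⊗ S(b)) = (S ⊗ S) flip ((b ⊗ 1)Δ(a))`. -/
theorem T₁_S_tmul_S (a b : A) : D.T₁ (X.S a ⊗ₜ X.S b) =
    TensorProduct.map X.S X.S (TensorProduct.comm K A A (D.T₂ (b ⊗ₜ a))) := by
  -- Write `φ(h) S(a)` as the slice `(id ⊗ φ)((1 ⊗ a)Δ(h))`, and apply strong left invariance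
  -- to the last two legs of `Δ²(h)`.
  refine D.tensor_ext_left fun c => smul_right_injective _ X.φ_h ?_
  simp only
  have h1 : X.φ X.h • (mulLeft K c).rTensor A (D.T₁ (X.S a ⊗ₜ X.S b)) =
      (mulRight K (X.S b) ∘ₗ X.S ∘ₗ X.lamR a).lTensor A (D.T₂ (c ⊗ₜ X.h)) := by
    have : X.S ∘ₗ X.lamR a = X.lamL (X.σ a) := by
      ext x
      simp [S_lam]
    rw [D.bridge, ← map_smul, ← map_smul, ← tmul_smul, ← lam_h_σ, ← lTensor_lamL_T₂, this,
      LinearMap.lTensor_comp_apply]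
  -- to be used for `z = (b ⊗ 1)Δ(a)`, and proved for elementary tensors
  have h2 : ∀ z : A ⊗[K] A, ∃ g : A →ₗ[K] A,
      (∀ x, g x = X.S (sliceR X.φ ((mulRight K x).lTensor A z))) ∧
      g.lTensor A (D.T₂ (c ⊗ₜ X.h)) = X.φ X.h • (mulLeft K c).rTensor A
        (TensorProduct.map X.S X.S (TensorProduct.comm K A A z)) := by
    intro z
    induction z with
    | zero => exact ⟨0, by simp⟩
    | tmul p q =>
      refine ⟨(X.φ ∘ₗ mulLeft K q).smulRight (X.S p), by simp, ?_⟩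
      have h3 : ∀ w : A ⊗[K] A, ((X.φ ∘ₗ mulLeft K q).smulRight (X.S p)).lTensor A w =
          sliceR X.φ ((mulLeft K q).lTensor A w) ⊗ₜ X.S p := by
        intro w
        induction w with
        | zero => simp
        | tmul u v => simp [smul_tmul]
        | add u v hu hv => simp only [map_add, add_tmul, hu, hv]
      rw [h3, ← mul_lam_σ, lam_h_σ]
      simp [mul_smul_comm, smul_tmul']
    | add u v hu hv =>
      obtain ⟨g, hg, hg'⟩ := hu
      obtain ⟨k, hk, hk'⟩ := hv
      exact ⟨g + k, by simp [hg, hk], by simp [LinearMap.lTensor_add, hg', hk']⟩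
  obtain ⟨g, hg, hg'⟩ := h2 (D.T₂ (b ⊗ₜ a))
  rw [h1, ← hg']
  congr 2
  ext x
  rw [hg, ← mul_lam, S_mul]
  simp

/-- `(S(b) ⊗ 1)Δ(S(a)) = (S ⊗ S) flip (Δ(a)(1 ⊗ b))`. -/
theorem T₂_S_tmul_S (a b : A) : D.T₂ (X.S b ⊗ₜ X.S a) =
    TensorProduct.map X.S X.S (TensorProduct.comm K A A (D.T₁ (a ⊗ₜ b))) := by
  have hl : ∀ (x : A) (z : A ⊗[K] A), (mulLeft K (X.S x)).rTensor A
      (TensorProduct.map X.S X.S (TensorProduct.comm K A A z)) =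
      TensorProduct.map X.S X.S (TensorProduct.comm K A A ((mulRight K x).lTensor A z)) := by
    intro x z
    induction z with
    | zero => simp
    | tmul u v => simp [S_mul]
    | add u v hu hv => simp only [map_add, hu, hv]
  have hr : ∀ (x : A) (z : A ⊗[K] A), (mulRight K (X.S x)).lTensor A
      (TensorProduct.map X.S X.S (TensorProduct.comm K A A z)) =
      TensorProduct.map X.S X.S (TensorProduct.comm K A A ((mulLeft K x).rTensor A z)) := by
    intro x z
    induction z with
    | zero => simp
    | tmul u v => simp [S_mul]
    | add u v hu hv => simp only [map_add, hu, hv]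
  refine D.tensor_ext_right fun c => ?_
  obtain ⟨c, rfl⟩ := X.S_surjective c
  rw [← D.bridge, T₁_S_tmul_S, hl, hr, D.bridge]

/-- `φ ∘ S` is right invariant. -/
lemma right_invariant (a b : A) :
    sliceL (X.φ ∘ₗ X.S) (D.T₁ (a ⊗ₜ b)) = X.φ (X.S a) • b := by
  apply X.S_injective
  rw [← sliceR_map_comm, ← T₂_S_tmul_S, X.left_invariant, map_smul]

lemma lam_S_S (a b : A) :
    X.lam (X.S a) (X.S b) = X.S (sliceL (X.φ ∘ₗ X.S) (D.T₂ (b ⊗ₜ a))) := by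
  rw [lam, T₁_S_tmul_S, sliceR_map_comm]

lemma lam_S (z y : A) :
    X.lam z (X.S y) = sliceL (X.φ ∘ₗ X.S) (D.T₂ (X.S z ⊗ₜ y)) := by
  apply X.S_injective
  rw [S_lam, ← S_S, lam_S_S]

/-- The adjunction `(φ ⊗ φ)(Δ(x)(z ⊗ y)) = (φ ⊗ φ)((x ⊗ 1)Δ(z)(1 ⊗ S(y)))`. -/
theorem φ_mul_lam_S (x y z : A) : X.φ (x * X.lam z (X.S y)) = X.φ (X.lam x y * z) := by
  calc X.φ (x * X.lam z (X.S y))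
      = (X.φ ∘ₗ mulLeft K x) (sliceL (X.φ ∘ₗ X.S) (D.T₂ (X.S z ⊗ₜ y))) := by rw [lam_S]; rfl
    _ = X.φ (X.S (X.S z * X.lam y (X.σ x))) := by
      rw [← apply_sliceR, mul_lam_σ, sliceR_lTensor]; rfl
    _ = X.φ (X.lam x y * z) := by
      rw [← S_lam, ← S_mul, S_S, φ_σ_mul]

/-- With `ψ = φ ∘ S`: `ψ((a ∗ b) x) = (ψ ⊗ ψ)((a ⊗ b)Δ(x))`. -/
theorem ψ_conv_mul (a b x : A) : X.φ (X.S (X.lam a (X.S b) * x)) =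
    X.φ (X.S (sliceR ((X.φ ∘ₗ X.S) ∘ₗ mulLeft K b) (D.T₂ (a ⊗ₜ x)))) := by
  have h := apply_sliceR (X.φ ∘ₗ X.S) ((X.φ ∘ₗ X.S) ∘ₗ mulLeft K b) (D.T₂ (a ⊗ₜ x))
  simp only [LinearMap.comp_apply, mulLeft_apply] at h
  rw [h, S_mul, S_lam, S_mul, ← lam_S_S, ← φ_mul_lam_S, S_S]

/-- The functionals `g_a = φ(S⁻¹(a) ·)` satisfy `g_b ∗ g_a = g_{a ∗ b}`; here `a` and `b` are
replaced by `S(a)` and `S(b)`. -/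
theorem φ_conv_mul (a b x y : A) (hy : X.S y = X.lam (X.S a) (X.S (X.S b))) :
    X.φ (y * x) = X.φ (sliceR (X.φ ∘ₗ mulLeft K a) (D.T₂ (b ⊗ₜ x))) := by
  rw [lam_S_S] at hy
  rw [X.S_injective hy, ← lam_S, ← φ_mul_lam_S, S_S, mul_lam_σ, sliceR_lTensor]

section Modular

variable {m : A →ₗ[K] A}

/-- If `φ(S(y)) = φ(y δ)`, then `(φ ⊗ id)(Δ(x)) = φ(x) δ`; here `m` is left multiplication by the
multiplier `δ`. -/
lemma sliceL_φ_T₁ (hm : ∀ y z, m (y * z) = m y * z) (hφ : ∀ y, X.φ (X.S y) = X.φ (m (X.σ y)))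
    (x y : A) : sliceL X.φ (D.T₁ (x ⊗ₜ y)) = X.φ x • m y := by
  have h1 : ∀ y, X.φ (sliceL X.φ (D.T₁ (x ⊗ₜ y))) = X.φ x * X.φ (m y) := by
    intro y
    obtain ⟨y, rfl⟩ := X.σ.surjective y
    have h := apply_sliceR (X.φ ∘ₗ X.S) X.φ (D.T₁ (y ⊗ₜ x))
    rw [← apply_sliceR, ← hφ, mul_comm]
    rw [right_invariant, map_smul, smul_eq_mul] at h
    rw [← h]
    exact congrArg X.φ (X.S_lam y x).symm
  have h2 : ∀ z, D.T₁ (x ⊗ₜ (y * z)) = (mulRight K z).lTensor A (D.T₁ (x ⊗ₜ y)) := by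
    intro z
    refine D.tensor_ext_left fun c => ?_
    have h3 : ∀ w : A ⊗[K] A, (mulLeft K c).rTensor A ((mulRight K z).lTensor A w) =
        (mulRight K z).lTensor A ((mulLeft K c).rTensor A w) := fun w => by
      rw [← LinearMap.comp_apply, ← LinearMap.comp_apply, rTensor_comp_lTensor,
        lTensor_comp_rTensor]
    rw [h3, D.bridge, D.bridge, ← LinearMap.lTensor_comp_apply]
    congr 2
    ext
    simp [mul_assoc]
  refine sub_eq_zero.1 (X.σ.injective ((X.faithful _ fun z => ?_).trans (map_zero _).symm))
  have h4 := h1 (y * z)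
  rw [h2, sliceL_lTensor, hm] at h4
  rw [← X.modular, sub_mul, map_sub, smul_mul_assoc, map_smul, smul_eq_mul, ← h4]
  simp

/-- If `φ(S(y)) = φ(y δ)`, then `Δ(δ) = δ ⊗ δ`; here `m` is left multiplication by the multiplier
`δ`. -/
theorem T₁_modular (hm : ∀ y z, m (y * z) = m y * z)
    (hφ : ∀ y, X.φ (X.S y) = X.φ (m (X.σ y))) (r s : A) :
    D.T₁ (m r ⊗ₜ s) = TensorProduct.map m m (D.T₁ (r ⊗ₜ s)) := by
  -- Coassociativity for `Δ²(h)(1 ⊗ w)`, sliced by `φ` in the first leg. As `(Δ ⊗ id)(Δ(h))` it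
  -- gives `φ(h) (δ ⊗ δ) w`, and as `(id ⊗ Δ)(Δ(h))`, with `w = Δ(r)(1 ⊗ s)`, it gives
  -- `φ(h) Δ(δ r)(1 ⊗ s)`.
  let Φ : A ⊗[K] (A ⊗[K] A) →ₗ[K] A ⊗[K] A :=
    (TensorProduct.lid K (A ⊗[K] A)).toLinearMap ∘ₗ X.φ.rTensor (A ⊗[K] A)
  have hΦ : ∀ a w, Φ (a ⊗ₜ w) = X.φ a • w := by simp [Φ]
  -- `Z` is `Δ²(h)(1 ⊗ w)` and `f q` is `Δ(q) w`.
  have h1 : ∀ w : A ⊗[K] A, ∃ Z : A ⊗[K] (A ⊗[K] A),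
      Φ Z = X.φ X.h • TensorProduct.map m m w ∧ ∃ f : A →ₗ[K] A ⊗[K] A,
        (∀ q, f q = comulL D.T₁.toLinearMap q w) ∧
        ∀ c, (mulLeft K c).rTensor _ Z = f.lTensor A (D.T₂ (c ⊗ₜ X.h)) := by
    intro w
    induction w with
    | zero => exact ⟨0, by simp, 0, by simp, by simp⟩
    | tmul y z =>
      refine ⟨TensorProduct.assoc K A A A
        ((D.T₁.toLinearMap ∘ₗ (TensorProduct.mk K A A).flip y).rTensor A (D.T₁ (X.h ⊗ₜ z))), ?_,
        (mulRight K y).rTensor A ∘ₗ D.T₁.toLinearMap ∘ₗ (TensorProduct.mk K A A).flip z,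
        by simp, fun c => ?_⟩
      · have h2 : ∀ v : A ⊗[K] A, Φ (TensorProduct.assoc K A A A
            ((D.T₁.toLinearMap ∘ₗ (TensorProduct.mk K A A).flip y).rTensor A v)) =
            m y ⊗ₜ sliceL X.φ v := by
          intro v
          induction v with
          | zero => simp
          | tmul a b =>
            have h3 : ∀ u : A ⊗[K] A, Φ (TensorProduct.assoc K A A A (u ⊗ₜ b)) =
                sliceL X.φ u ⊗ₜ b := by
              intro u
              induction u with
              | zero => simp
              | tmul p q => simp [hΦ, smul_tmul']
              | add p q hp hq => simp only [map_add, add_tmul, hp, hq]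
            rw [rTensor_tmul, h3]
            simp [X.sliceL_φ_T₁ hm hφ, smul_tmul]
          | add p q hp hq => simp only [map_add, tmul_add, hp, hq]
        rw [h2, X.sliceL_φ_T₁ hm hφ]
        simp
      · have h2 : ∀ v : A ⊗[K] A, (mulLeft K c).rTensor _ (TensorProduct.assoc K A A A
            ((D.T₁.toLinearMap ∘ₗ (TensorProduct.mk K A A).flip y).rTensor A v)) =
            ((mulRight K y).rTensor A).lTensor A (TensorProduct.assoc K A A A
              (D.T₂.toLinearMap.rTensor A ((TensorProduct.assoc K A A A).symm (c ⊗ₜ v)))) := by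
          intro v
          induction v with
          | zero => simp
          | tmul a b =>
            have h3 : ∀ u : A ⊗[K] A, (mulLeft K c).rTensor _
                (TensorProduct.assoc K A A A (u ⊗ₜ b)) =
                TensorProduct.assoc K A A A ((mulLeft K c).rTensor A u ⊗ₜ b) := by
              intro u
              induction u with
              | zero => simp
              | tmul p q => simp
              | add p q hp hq => simp only [map_add, add_tmul, hp, hq]
            have h4 : ∀ u : A ⊗[K] A, TensorProduct.assoc K A A A
                ((mulRight K y).lTensor A u ⊗ₜ b) =
                ((mulRight K y).rTensor A).lTensor A (TensorProduct.assoc K A A A (u ⊗ₜ b)) := by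
              intro u
              induction u with
              | zero => simp
              | tmul p q => simp
              | add p q hp hq => simp only [map_add, add_tmul, hp, hq]
            have h5 := D.bridge c a y
            simp only [rTensor_tmul, h3, assoc_symm_tmul, LinearMap.comp_apply, flip_apply,
              mk_apply, LinearEquiv.coe_coe, h5, h4]
          | add p q hp hq => simp only [map_add, tmul_add, hp, hq]
        rw [h2, D.coassoc, LinearEquiv.apply_symm_apply, LinearMap.lTensor_comp_apply]
        congr 1
        generalize D.T₂ (c ⊗ₜ X.h) = u
        induction u with
        | zero => simp
        | tmul p q => simp
        | add p q hp hq => simp only [map_add, add_tmul, hp, hq]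
    | add u v hu hv =>
      obtain ⟨Z, hZ, f, hf, hfZ⟩ := hu
      obtain ⟨W, hW, g, hg, hgW⟩ := hv
      exact ⟨Z + W, by simp only [map_add, hZ, hW, smul_add], f + g, by simp [hf, hg], fun c => by
        simp only [map_add, hfZ, hgW, LinearMap.lTensor_add, LinearMap.add_apply]⟩
  obtain ⟨Z, hZ, f, hf, hfZ⟩ := h1 (D.T₁ (r ⊗ₜ s))
  have h2 : (D.T₁.toLinearMap ∘ₗ (TensorProduct.mk K A A).flip s).lTensor A (D.T₁ (X.h ⊗ₜ r)) =
      Z := by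
    refine D.tensor_ext_left fun c => ?_
    have h3 : ∀ u : A ⊗[K] A, (mulLeft K c).rTensor _
        ((D.T₁.toLinearMap ∘ₗ (TensorProduct.mk K A A).flip s).lTensor A u) =
        (D.T₁.toLinearMap ∘ₗ (TensorProduct.mk K A A).flip s).lTensor A
          ((mulLeft K c).rTensor A u) := fun u => by
      rw [← LinearMap.comp_apply, ← LinearMap.comp_apply, rTensor_comp_lTensor,
        lTensor_comp_rTensor]
    rw [h3, D.bridge, hfZ, ← LinearMap.lTensor_comp_apply]
    congr 2
    ext q
    simp [hf, ← D.T₁_mul]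
  have h4 : ∀ u : A ⊗[K] A,
      Φ ((D.T₁.toLinearMap ∘ₗ (TensorProduct.mk K A A).flip s).lTensor A u) =
        D.T₁ (sliceL X.φ u ⊗ₜ s) := by
    intro u
    induction u with
    | zero => simp
    | tmul p q => simp [hΦ, ← smul_tmul']
    | add p q hp hq => simp only [map_add, add_tmul, hp, hq]
  rw [← h2, h4, X.sliceL_φ_T₁ hm hφ, ← smul_tmul', map_smul] at hZ
  exact smul_right_injective _ X.φ_h hZ

end Modular

end HaarData
end CoveredHopf
end

/-! ### The blocks of `𝒜₀` -/

noncomputable section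

namespace DQG

open TensorProduct LinearMap CoveredHopf

section Blocks

variable {I : Type*} {n : I → ℕ}

open Classical in
/-- The matrix `m`, as an element of the block `M_{n α}(ℂ)` of `𝒜₀`. -/
def block (n : I → ℕ) (α : I) : Matrix (Fin (n α)) (Fin (n α)) ℂ →ₗ[ℂ] A₀ n where
  toFun m := ⟨Pi.single α m, (Set.finite_singleton α).subset fun β h => by
    by_contra hc
    exact h (Pi.single_eq_of_ne hc _)⟩
  map_add' a b := Subtype.ext (Pi.single_add _ _ _)
  map_smul' c a := Subtype.ext (Pi.single_smul _ _ _)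

@[simp] lemma block_apply_same (α : I) (m : Matrix (Fin (n α)) (Fin (n α)) ℂ) :
    (block n α m : Mult n) α = m := by simp [block]

lemma block_apply_ne {α β : I} (h : β ≠ α) (m : Matrix (Fin (n α)) (Fin (n α)) ℂ) :
    (block n α m : Mult n) β = 0 := by
  classical
  simp [block, Pi.single_eq_of_ne h]

lemma matUnit_eq_block (α : I) (i j : Fin (n α)) :
    matUnit n α i j = block n α (Matrix.single i j 1) := by
  apply Subtype.ext
  simp only [matUnit, block, LinearMap.coe_mk, AddHom.coe_mk]

lemma coe_sum {ι : Type*} (s : Finset ι) (f : ι → A₀ n) (α : I) :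
    ((∑ i ∈ s, f i : A₀ n) : Mult n) α = ∑ i ∈ s, (f i : Mult n) α :=
  map_sum (LinearMap.proj α ∘ₗ (A₀ n).toSubmodule.subtype : A₀ n →ₗ[ℂ] _) f s

/-- The finite set of blocks that meet `a`. -/
def supp (a : A₀ n) : Finset I := a.2.toFinset

lemma apply_eq_zero {a : A₀ n} {α : I} (h : α ∉ supp a) : (a : Mult n) α = 0 := by
  by_contra hc
  exact h ((Set.Finite.mem_toFinset _).2 hc)

lemma eq_sum_block (a : A₀ n) {s : Finset I} (hs : supp a ⊆ s) :
    a = ∑ α ∈ s, block n α ((a : Mult n) α) := by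
  classical
  apply Subtype.ext
  funext α
  rw [coe_sum]
  by_cases h : α ∈ s
  · rw [Finset.sum_eq_single_of_mem α h fun β _ hβ => block_apply_ne hβ.symm _, block_apply_same]
  · rw [Finset.sum_eq_zero, apply_eq_zero fun h' => h (hs h')]
    exact fun β hβ => block_apply_ne (fun h' : α = β => h (h'.symm ▸ hβ)) _

lemma block_eq_sum (α : I) (m : Matrix (Fin (n α)) (Fin (n α)) ℂ) :
    block n α m = ∑ i, ∑ j, m i j • matUnit n α i j := by
  conv_lhs => rw [Matrix.matrix_eq_sum_single m]
  simp only [map_sum, matUnit_eq_block, ← map_smul, Matrix.smul_single, smul_eq_mul, mul_one]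

@[elab_as_elim]
lemma block_induction {p : A₀ n → Prop} (a : A₀ n) (zero : p 0)
    (add : ∀ a b, p a → p b → p (a + b)) (block : ∀ α m, p (block n α m)) : p a := by
  classical
  rw [eq_sum_block a subset_rfl]
  induction supp a using Finset.induction_on with
  | empty => simpa using zero
  | insert α s hα ih =>
    rw [Finset.sum_insert hα]
    exact add _ _ (block _ _) ih

lemma block_mul_block (α : I) (m m' : Matrix (Fin (n α)) (Fin (n α)) ℂ) :
    block n α m * block n α m' = block n α (m * m') := by
  apply Subtype.ext
  funext β
  change (block n α m : Mult n) β * (block n α m' : Mult n) β = _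
  by_cases h : β = α
  · subst h
    simp
  · rw [block_apply_ne h, block_apply_ne h, zero_mul, block_apply_ne h]

lemma star_block (α : I) (m : Matrix (Fin (n α)) (Fin (n α)) ℂ) :
    star (block n α m) = block n α (star m) := by
  classical
  apply Subtype.ext
  funext β
  change star ((block n α m : Mult n) β) = _
  by_cases h : β = α
  · subst h
    simp
  · rw [block_apply_ne h, block_apply_ne h, star_zero]

lemma sandwich_block (x y : Mult n) (α : I) (m : Matrix (Fin (n α)) (Fin (n α)) ℂ) :
    sandwich x (block n α m) y = block n α (x α * m * y α) := by
  apply Subtype.ext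
  funext β
  change x β * (block n α m : Mult n) β * y β = _
  by_cases h : β = α
  · subst h
    simp
  · rw [block_apply_ne h, block_apply_ne h, mul_zero, zero_mul]

lemma sandwich_apply (x y : Mult n) (a : A₀ n) (α : I) :
    (sandwich x a y : Mult n) α = x α * (a : Mult n) α * y α := rfl

/-- `sandwich` as a linear map. -/
def sandwichL (x y : Mult n) : A₀ n →ₗ[ℂ] A₀ n where
  toFun a := sandwich x a y
  map_add' a b := Subtype.ext (by funext α; simp [sandwich, mul_add, add_mul])
  map_smul' c a := Subtype.ext (by funext α; simp [sandwich])

@[simp] lemma sandwichL_apply (x y : Mult n) (a : A₀ n) : sandwichL x y a = sandwich x a y := rfl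

/-- The unit of the blocks in the finite set `t`. -/
def unitOn (n : I → ℕ) (t : Finset I) : A₀ n := ∑ α ∈ t, block n α 1

lemma unitOn_apply {t : Finset I} {α : I} (h : α ∈ t) : (unitOn n t : Mult n) α = 1 := by
  rw [unitOn, coe_sum, Finset.sum_eq_single_of_mem α h fun β _ hβ => block_apply_ne hβ.symm _,
    block_apply_same]

lemma unitOn_apply_eq_zero {t : Finset I} {α : I} (h : α ∉ t) : (unitOn n t : Mult n) α = 0 := by
  rw [unitOn, coe_sum]
  exact Finset.sum_eq_zero fun β hβ =>
    block_apply_ne (fun h' : α = β => h (h'.symm ▸ hβ)) _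

lemma unitOn_mul {t : Finset I} {a : A₀ n} (h : supp a ⊆ t) : unitOn n t * a = a := by
  apply Subtype.ext
  funext α
  change (unitOn n t : Mult n) α * (a : Mult n) α = _
  by_cases hα : α ∈ t
  · rw [unitOn_apply hα, one_mul]
  · rw [apply_eq_zero fun h' => hα (h h'), mul_zero]

lemma mul_unitOn {t : Finset I} {a : A₀ n} (h : supp a ⊆ t) : a * unitOn n t = a := by
  apply Subtype.ext
  funext α
  change (a : Mult n) α * (unitOn n t : Mult n) α = _
  by_cases hα : α ∈ t
  · rw [unitOn_apply hα, mul_one]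
  · rw [apply_eq_zero fun h' => hα (h h'), zero_mul]

lemma exists_local_unit (s : Finset (A₀ n)) : ∃ e : A₀ n, ∀ a ∈ s, e * a = a ∧ a * e = a := by
  classical
  exact ⟨unitOn n (s.biUnion supp), fun a ha =>
    ⟨unitOn_mul (Finset.subset_biUnion_of_mem supp ha),
      mul_unitOn (Finset.subset_biUnion_of_mem supp ha)⟩⟩

end Blocks

section Inclusion

variable {I : Type*} {n : I → ℕ}

lemma kron_apply (a b : Mult n) (α β : I) : kron n a b α β = a α ⊗ₖ b β := rfl

@[simp] lemma incl_tmul (a b : A₀ n) : incl n (a ⊗ₜ b) = kron n a b := rfl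

lemma kron_mul_kron (a a' b b' : Mult n) :
    kron n a b * kron n a' b' = kron n (a * a') (b * b') := by
  funext α β
  exact (Matrix.mul_kronecker_mul (a α) (a' α) (b β) (b' β)).symm

lemma incl_rTensor_mulLeft (c : A₀ n) (z : A₀ n ⊗[ℂ] A₀ n) :
    incl n ((mulLeft ℂ c).rTensor (A₀ n) z) = kron n c 1 * incl n z := by
  induction z with
  | zero => simp
  | tmul a b => simp [kron_mul_kron]
  | add x y hx hy => simp only [map_add, hx, hy, mul_add]

lemma incl_rTensor_mulRight (c : A₀ n) (z : A₀ n ⊗[ℂ] A₀ n) :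
    incl n ((mulRight ℂ c).rTensor (A₀ n) z) = incl n z * kron n c 1 := by
  induction z with
  | zero => simp
  | tmul a b => simp [kron_mul_kron]
  | add x y hx hy => simp only [map_add, hx, hy, add_mul]

lemma incl_lTensor_mulLeft (c : A₀ n) (z : A₀ n ⊗[ℂ] A₀ n) :
    incl n ((mulLeft ℂ c).lTensor (A₀ n) z) = kron n 1 c * incl n z := by
  induction z with
  | zero => simp
  | tmul a b => simp [kron_mul_kron]
  | add x y hx hy => simp only [map_add, hx, hy, mul_add]

lemma incl_lTensor_mulRight (c : A₀ n) (z : A₀ n ⊗[ℂ] A₀ n) :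
    incl n ((mulRight ℂ c).lTensor (A₀ n) z) = incl n z * kron n 1 c := by
  induction z with
  | zero => simp
  | tmul a b => simp [kron_mul_kron]
  | add x y hx hy => simp only [map_add, hx, hy, add_mul]

/-- A tensor in `𝒜₀ ⊗ 𝒜₀` is recovered from the entries of its image in `Mult₂`. -/
lemma exists_eq_sum_incl (z : A₀ n ⊗[ℂ] A₀ n) : ∃ s : Finset I, ∀ t, s ⊆ t →
    z = ∑ α ∈ t, ∑ β ∈ t, ∑ i, ∑ j, ∑ k, ∑ l,
      incl n z α β (i, k) (j, l) • (matUnit n α i j ⊗ₜ[ℂ] matUnit n β k l) := by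
  classical
  induction z with
  | zero => exact ⟨∅, by simp⟩
  | tmul a b =>
    refine ⟨supp a ∪ supp b, fun t ht => ?_⟩
    conv_lhs => rw [eq_sum_block a (Finset.union_subset_left ht),
      eq_sum_block b (Finset.union_subset_right ht)]
    rw [sum_tmul]
    refine Finset.sum_congr rfl fun α _ => ?_
    rw [tmul_sum]
    refine Finset.sum_congr rfl fun β _ => ?_
    rw [block_eq_sum, block_eq_sum]
    simp only [sum_tmul]
    simp only [tmul_sum, smul_tmul_smul, incl_tmul, kron_apply, Matrix.kroneckerMap_apply]
  | add x y hx hy =>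
    obtain ⟨s, hs⟩ := hx
    obtain ⟨t, ht⟩ := hy
    refine ⟨s ∪ t, fun r hr => ?_⟩
    conv_lhs => rw [hs r (Finset.union_subset_left hr), ht r (Finset.union_subset_right hr)]
    simp only [← Finset.sum_add_distrib, ← add_smul]
    rw [map_add]
    rfl

lemma incl_injective : Function.Injective (incl n) := by
  refine (injective_iff_map_eq_zero _).2 fun z hz => ?_
  obtain ⟨s, hs⟩ := exists_eq_sum_incl z
  rw [hs s subset_rfl, hz]
  simp

end Inclusion

namespace DiscreteQuantumGroup

variable {I : Type*} (G : DiscreteQuantumGroup I)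

lemma incl_comulL (p : A₀ G.n) (z : A₀ G.n ⊗[ℂ] A₀ G.n) :
    incl G.n (comulL G.T₁.toLinearMap p z) = G.Δ p * incl G.n z := by
  induction z with
  | zero => simp
  | tmul a b =>
    rw [comulL_tmul, incl_rTensor_mulRight, LinearEquiv.coe_coe, G.T₁_tmul, mul_assoc,
      kron_mul_kron, incl_tmul, one_mul, mul_one]
  | add x y hx hy => simp only [map_add, hx, hy, mul_add]

lemma incl_comulR (x : A₀ G.n) (z : A₀ G.n ⊗[ℂ] A₀ G.n) :
    incl G.n (comulR G.T₂.toLinearMap x z) = incl G.n z * G.Δ x := by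
  induction z with
  | zero => simp
  | tmul a b =>
    rw [comulR_tmul, incl_lTensor_mulLeft, LinearEquiv.coe_coe, G.T₂_tmul, ← mul_assoc,
      kron_mul_kron, incl_tmul, one_mul, mul_one]
  | add x y hx hy => simp only [map_add, hx, hy, add_mul]

/-- The comultiplication of a discrete quantum group, without its multipliers. -/
def covered : CoveredComul ℂ (A₀ G.n) where
  T₁ := G.T₁
  T₂ := G.T₂
  bridge c x y := incl_injective (by
    rw [incl_rTensor_mulLeft, incl_lTensor_mulRight, G.T₁_tmul, G.T₂_tmul, mul_assoc])
  T₁_mul p r s := incl_injective (by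
    rw [incl_comulL, G.T₁_tmul, G.T₁_tmul, map_mul, mul_assoc])
  T₂_mul p q x := incl_injective (by
    rw [incl_comulR, G.T₂_tmul, G.T₂_tmul, map_mul, mul_assoc])
  coassoc := G.coassoc
  local_units := exists_local_unit

lemma covered_isCounit_counit : G.covered.IsCounit G.counit :=
  Classical.epsilon_spec (p := G.IsCounit) G.covered.exists_isCounit

/-- `Δ` is nondegenerate in each block: some finite sum of block units is mapped to `1`. -/
lemma exists_Δ_unitOn (α β : I) : ∃ t, G.Δ (unitOn G.n t) α β = 1 := by
  classical
  have h : ∀ w, ∃ s, ∀ t, s ⊆ t → G.Δ (unitOn G.n t) * incl G.n (G.T₁ w) = incl G.n (G.T₁ w) := by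
    intro w
    induction w with
    | zero => exact ⟨∅, by simp⟩
    | tmul a b =>
      refine ⟨supp a, fun t ht => ?_⟩
      rw [G.T₁_tmul, ← mul_assoc, ← map_mul, unitOn_mul ht]
    | add x y hx hy =>
      obtain ⟨s, hs⟩ := hx
      obtain ⟨t, ht⟩ := hy
      refine ⟨s ∪ t, fun r hr => ?_⟩
      rw [map_add, map_add, mul_add, hs r (Finset.union_subset_left hr),
        ht r (Finset.union_subset_right hr)]
  obtain ⟨s, hs⟩ := h (G.T₁.symm (block G.n α 1 ⊗ₜ block G.n β 1))
  have h1 := congrFun (congrFun (hs s subset_rfl) α) β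
  rw [LinearEquiv.apply_symm_apply] at h1
  change G.Δ _ α β * incl G.n (block G.n α 1 ⊗ₜ block G.n β 1) α β = _ at h1
  rw [incl_tmul, kron_apply, block_apply_same, block_apply_same, Matrix.one_kronecker_one,
    mul_one] at h1
  exact ⟨s, h1⟩

end DiscreteQuantumGroup
end DQG
end

/-! ### Densities and the modular automorphism -/

noncomputable section

namespace DQG

open TensorProduct LinearMap CoveredHopf

section Density

variable {I : Type*} {n : I → ℕ}

/-- The densities of a functional with respect to the traces of the blocks,
`f(m) = tr(dens f α · m)` for `m` in `M_{n α}(ℂ)`. -/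
def dens (f : A₀ n →ₗ[ℂ] ℂ) : Mult n := fun α => Matrix.of fun i j => f (matUnit n α j i)

lemma apply_block (f : A₀ n →ₗ[ℂ] ℂ) (α : I) (m : Matrix (Fin (n α)) (Fin (n α)) ℂ) :
    f (block n α m) = (dens f α * m).trace := by
  rw [block_eq_sum]
  simp only [map_sum, map_smul, smul_eq_mul, Matrix.trace, Matrix.diag_apply, Matrix.mul_apply,
    dens, Matrix.of_apply]
  rw [Finset.sum_comm]
  exact Finset.sum_congr rfl fun i _ => Finset.sum_congr rfl fun j _ => mul_comm _ _

lemma functional_ext {M : Type*} [AddCommMonoid M] [Module ℂ M] {f g : A₀ n →ₗ[ℂ] M}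
    (h : ∀ α m, f (block n α m) = g (block n α m)) : f = g := by
  ext a
  induction a using block_induction with
  | zero => simp
  | add a b ha hb => rw [map_add, map_add, ha, hb]
  | block α m => exact h α m

lemma mul_block (a : A₀ n) (α : I) (m : Matrix (Fin (n α)) (Fin (n α)) ℂ) :
    a * block n α m = block n α ((a : Mult n) α * m) := by
  apply Subtype.ext
  funext β
  change (a : Mult n) β * (block n α m : Mult n) β = _
  by_cases h : β = α
  · subst h
    simp
  · rw [block_apply_ne h, block_apply_ne h, mul_zero]

lemma block_mul (a : A₀ n) (α : I) (m : Matrix (Fin (n α)) (Fin (n α)) ℂ) :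
    block n α m * a = block n α (m * (a : Mult n) α) := by
  apply Subtype.ext
  funext β
  change (block n α m : Mult n) β * (a : Mult n) β = _
  by_cases h : β = α
  · subst h
    simp
  · rw [block_apply_ne h, block_apply_ne h, zero_mul]

lemma block_ne_zero {α : I} {m : Matrix (Fin (n α)) (Fin (n α)) ℂ} (hm : m ≠ 0) :
    block n α m ≠ 0 := fun h => hm (by
  have := congrFun (congrArg Subtype.val h) α
  rwa [block_apply_same] at this)

end Density

section Matrix

open Matrix

/-- Two matrices with the same trace pairings are equal. -/
lemma eq_of_trace_mul_eq {k : ℕ} {x y : Matrix (Fin k) (Fin k) ℂ}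
    (h : ∀ m, (x * m).trace = (y * m).trace) : x = y := by
  ext i j
  have := h (Matrix.single j i 1)
  simpa [Matrix.trace_mul_single] using this

/-- Over `ℂ`, positivity of the quadratic form forces the matrix to be Hermitian. -/
lemma posDef_of_dotProduct_pos {k : ℕ} {x : Matrix (Fin k) (Fin k) ℂ}
    (h : ∀ v : Fin k → ℂ, v ≠ 0 → 0 < star v ⬝ᵥ (x *ᵥ v)) : x.PosDef := by
  refine Matrix.PosDef.of_dotProduct_mulVec_pos ?_ h
  rw [← Matrix.isSymmetric_toEuclideanLin_iff, LinearMap.isSymmetric_iff_inner_map_self_real]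
  intro v
  have hv : ∀ v : Fin k → ℂ, star (star v ⬝ᵥ (x *ᵥ v)) = star v ⬝ᵥ (x *ᵥ v) := by
    intro v
    by_cases h0 : v = 0
    · simp [h0]
    · exact (h v h0).le.isSelfAdjoint
  have := hv v.ofLp
  rw [inner_conj_symm, ← inner_conj_symm (x.toEuclideanLin v) v,
    EuclideanSpace.inner_eq_star_dotProduct]
  simp only [Matrix.ofLp_toLpLin, Matrix.toLin'_apply]
  rw [dotProduct_comm]
  exact this.symm

open scoped MatrixOrder in
lemma eq_of_sq_eq_sq {m : Type*} [Fintype m] [DecidableEq m] {x y : Matrix m m ℂ}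
    (hx : x.PosSemidef) (hy : y.PosSemidef) (h : x ^ 2 = y ^ 2) : x = y :=
  open scoped Matrix.Norms.L2Operator in
  (CFC.sq_eq_sq_iff x y (Matrix.nonneg_iff_posSemidef.2 hx) (Matrix.nonneg_iff_posSemidef.2 hy)).1 h

open scoped MatrixOrder in
lemma exists_eq_star_mul_self {m : Type*} [Fintype m] [DecidableEq m] {x : Matrix m m ℂ}
    (hx : x.PosSemidef) : ∃ y, x = star y * y :=
  open scoped Matrix.Norms.L2Operator in
  CStarAlgebra.nonneg_iff_eq_star_mul_self.1 (Matrix.nonneg_iff_posSemidef.2 hx)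

lemma exists_eq_smul_one_of_commute {k : ℕ} {x : Matrix (Fin k) (Fin k) ℂ}
    (h : ∀ m, m * x = x * m) : ∃ c : ℂ, x = c • (1 : Matrix (Fin k) (Fin k) ℂ) := by
  obtain ⟨c, hc⟩ := Matrix.mem_range_scalar_of_commute_single (M := x) fun i j _ => h _
  exact ⟨c, by rw [← hc, Matrix.scalar_apply, Matrix.smul_one_eq_diagonal]⟩

end Matrix

namespace DiscreteQuantumGroup

variable {I : Type*} {G : DiscreteQuantumGroup I} {φ : A₀ G.n →ₗ[ℂ] ℂ}

lemma IsLeftHaar.pos (hφ : G.IsLeftHaar φ) {a : A₀ G.n} (ha : a ≠ 0) : 0 < φ (star a * a) :=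
  lt_of_le_of_ne (hφ.nonneg a) fun h => ha (hφ.faithful a h.symm)

open Matrix in
/-- The densities of a positive faithful functional are positive definite. -/
lemma IsLeftHaar.posDef_dens (hφ : G.IsLeftHaar φ) (α : I) : (dens φ α).PosDef := by
  refine posDef_of_dotProduct_pos fun v hv => ?_
  let i₀ : Fin (G.n α) := ⟨0, G.n_pos α⟩
  -- `m` has first row `v*` and no other entries, so that `m* m = v v*`.
  let m : Matrix (Fin (G.n α)) (Fin (G.n α)) ℂ := vecMulVec (Pi.single i₀ 1) (star v)
  have hm : m ≠ 0 := by
    intro h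
    apply hv
    ext j
    have := congrFun (congrFun h i₀) j
    simpa [m, vecMulVec_apply] using this
  have h := hφ.pos (block_ne_zero hm)
  rw [star_block, block_mul_block, apply_block] at h
  have hmm : star m * m = vecMulVec v (star v) := by
    ext i j
    simp [m, Matrix.mul_apply, vecMulVec_apply, Pi.single_apply, star_eq_conjTranspose]
  rw [hmm, mul_vecMulVec, trace_vecMulVec, dotProduct_comm] at h
  exact h

/-- The counit is supported in a single one-dimensional block, whose unit is a two-sided
cointegral. -/
lemma exists_cointegral (G : DiscreteQuantumGroup I) [Nonempty I] : ∃ h : A₀ G.n, h ≠ 0 ∧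
    star h * h = h ∧ ∀ a, a * h = G.counit a • h ∧ h * a = G.counit a • h := by
  have hmul := G.covered_isCounit_counit.map_mul
  have hne : G.counit ≠ 0 := by
    intro h
    obtain ⟨α⟩ := ‹Nonempty I›
    have : Nonempty (Fin (G.n α)) := ⟨⟨0, G.n_pos α⟩⟩
    have h1 := (G.covered_isCounit_counit (block G.n α 1) (block G.n α 1)).1
    rw [h, block_mul_block, mul_one] at h1
    refine block_ne_zero one_ne_zero (h1.symm.trans ?_)
    simp [sliceL]
  obtain ⟨α, i, j, hij⟩ : ∃ α i j, G.counit (matUnit G.n α i j) ≠ 0 := by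
    by_contra! hc
    refine hne (functional_ext fun α m => ?_)
    rw [block_eq_sum]
    simp [hc]
  have hprod : ∀ p q r : Fin (G.n α), matUnit G.n α p q * matUnit G.n α q r =
      matUnit G.n α p r := by
    intro p q r
    simp [matUnit_eq_block, block_mul_block]
  have hii : G.counit (matUnit G.n α i i) ≠ 0 := by
    intro h
    rw [← hprod i i j, hmul, h, zero_mul] at hij
    exact hij rfl
  have hsub : ∀ k, k = i := by
    intro k
    by_contra hk
    have h1 : G.counit (matUnit G.n α i k) * G.counit (matUnit G.n α i k) = 0 := by
      rw [← hmul, matUnit_eq_block, block_mul_block, Matrix.single_mul_single_of_ne _ _ _ _ hk]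
      simp
    have h2 : G.counit (matUnit G.n α i k) = 0 := mul_self_eq_zero.1 h1
    rw [← hprod i k i, hmul, h2, zero_mul] at hii
    exact hii rfl
  have hone : ∀ m : Matrix (Fin (G.n α)) (Fin (G.n α)) ℂ, m = m i i • 1 := by
    intro m
    ext p q
    rw [hsub p, hsub q]
    simp
  have hh : G.counit (block G.n α 1) ≠ 0 := by
    intro h
    have h1 := hmul (block G.n α 1) (matUnit G.n α i i)
    rw [matUnit_eq_block, block_mul_block, one_mul, ← matUnit_eq_block, h, zero_mul] at h1
    exact hii h1
  have : Nonempty (Fin (G.n α)) := ⟨i⟩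
  refine ⟨block G.n α 1, block_ne_zero one_ne_zero, ?_, fun a => ?_⟩
  · rw [star_block, block_mul_block, star_one, mul_one]
  · have hc : (a : Mult G.n) α i i = G.counit a := by
      have h1 := hmul a (block G.n α 1)
      rw [mul_block, mul_one, hone ((a : Mult G.n) α), map_smul, map_smul, smul_eq_mul] at h1
      exact mul_right_cancel₀ hh h1
    rw [mul_block, block_mul, mul_one, one_mul, hone ((a : Mult G.n) α), hc, map_smul]
    exact ⟨rfl, rfl⟩

/-- The blockwise inverse of `dens φ`. -/
def densInv (φ : A₀ G.n →ₗ[ℂ] ℂ) : Mult G.n := fun α => (dens φ α)⁻¹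

lemma IsLeftHaar.dens_mul_inv (hφ : G.IsLeftHaar φ) (α : I) : dens φ α * (dens φ α)⁻¹ = 1 :=
  Matrix.mul_nonsing_inv _ ((Matrix.isUnit_iff_isUnit_det _).1 (hφ.posDef_dens α).isUnit)

lemma IsLeftHaar.inv_mul_dens (hφ : G.IsLeftHaar φ) (α : I) : (dens φ α)⁻¹ * dens φ α = 1 :=
  Matrix.nonsing_inv_mul _ ((Matrix.isUnit_iff_isUnit_det _).1 (hφ.posDef_dens α).isUnit)

/-- The modular automorphism `a ↦ ρ a ρ⁻¹` of `φ = tr(ρ ·)`. -/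
def IsLeftHaar.modularAut (hφ : G.IsLeftHaar φ) : A₀ G.n ≃ₗ[ℂ] A₀ G.n :=
  LinearEquiv.ofLinearMap (sandwichL (dens φ) (densInv φ)) (sandwichL (densInv φ) (dens φ))
    (functional_ext fun α m => by
      simp only [LinearMap.comp_apply, sandwichL_apply, sandwich_block, densInv, LinearMap.id_apply]
      simp only [← mul_assoc, hφ.dens_mul_inv, one_mul]
      rw [mul_assoc, hφ.dens_mul_inv, mul_one])
    (functional_ext fun α m => by
      simp only [LinearMap.comp_apply, sandwichL_apply, sandwich_block, densInv, LinearMap.id_apply]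
      simp only [← mul_assoc, hφ.inv_mul_dens, one_mul]
      rw [mul_assoc, hφ.inv_mul_dens, mul_one])

lemma IsLeftHaar.modularAut_block (hφ : G.IsLeftHaar φ) (α : I)
    (m : Matrix (Fin (G.n α)) (Fin (G.n α)) ℂ) :
    hφ.modularAut (block G.n α m) = block G.n α (dens φ α * m * (dens φ α)⁻¹) :=
  sandwich_block _ _ _ _

/-- The Haar functional, its modular automorphism, the counit and the cointegral. -/
def IsLeftHaar.haarData [Nonempty I] (hφ : G.IsLeftHaar φ) : HaarData G.covered where
  φ := φ
  σ := hφ.modularAut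
  ε := G.counit
  h := G.exists_cointegral.choose
  isCounit := G.covered_isCounit_counit
  left_invariant := hφ.invariant
  modular a b := by
    have h : φ ∘ₗ mulLeft ℂ a = φ ∘ₗ mulRight ℂ (hφ.modularAut a) := functional_ext fun α m => by
      have h1 : ((hφ.modularAut a : A₀ G.n) : Mult G.n) α =
        dens φ α * (a : Mult G.n) α * (dens φ α)⁻¹ := rfl
      simp only [LinearMap.comp_apply, mulLeft_apply, mulRight_apply]
      rw [mul_block, block_mul, apply_block, apply_block, h1, ← mul_assoc,
        ← mul_assoc m, ← mul_assoc (dens φ α) (m * _), Matrix.trace_mul_comm (_ * _) (_⁻¹),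
        ← mul_assoc, ← mul_assoc, hφ.inv_mul_dens, one_mul, Matrix.trace_mul_comm]
    exact LinearMap.congr_fun h b
  faithful a ha := hφ.faithful a (ha _)
  mul_h a := (G.exists_cointegral.choose_spec.2.2 a).1
  h_mul a := (G.exists_cointegral.choose_spec.2.2 a).2
  φ_h := by
    obtain ⟨h1, h2, -⟩ := G.exists_cointegral.choose_spec
    rw [← h2]
    exact (hφ.pos h1).ne'

lemma IsLeftHaar.antipode_eq [Nonempty I] (hφ : G.IsLeftHaar φ) : G.antipode = hφ.haarData.S :=
  CoveredComul.IsAntipode.eq (D := G.covered) (ε := G.counit)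
    (Classical.epsilon_spec (p := G.IsAntipode) ⟨_, hφ.haarData.isAntipode⟩)
    hφ.haarData.isAntipode

end DiscreteQuantumGroup

end DQG
end

/-! ### The positive root of the modular element -/

noncomputable section

namespace DQG

open TensorProduct LinearMap CoveredHopf

namespace DiscreteQuantumGroup

variable {I : Type*} {G : DiscreteQuantumGroup I} {φ : A₀ G.n →ₗ[ℂ] ℂ}

/-- `φ(S(p)) > 0` for the unit `p` of a block, as `S(p)` is a nonzero central idempotent, hence a
sum of units of blocks. -/
lemma IsLeftHaar.antipode_block_one_pos [Nonempty I] (hφ : G.IsLeftHaar φ) (α : I) :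
    0 < φ (hφ.haarData.S (block G.n α 1)) := by
  have : Nonempty (Fin (G.n α)) := ⟨⟨0, G.n_pos α⟩⟩
  set X := hφ.haarData
  set p := X.S (block G.n α 1) with hp
  have hp0 : p ≠ 0 := fun h => block_ne_zero one_ne_zero
    (X.S_injective (h.trans (map_zero X.S).symm))
  have hpp : p * p = p := by rw [hp, ← X.S_mul, block_mul_block, mul_one]
  have hcomm : ∀ a, a * p = p * a := by
    intro a
    obtain ⟨a, rfl⟩ := X.S_surjective a
    rw [hp, ← X.S_mul, ← X.S_mul, mul_block, block_mul, mul_one, one_mul]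
  have hstar : star p * p = p := by
    apply Subtype.ext
    funext β
    change star ((p : Mult G.n) β) * (p : Mult G.n) β = (p : Mult G.n) β
    obtain ⟨c, hc⟩ := exists_eq_smul_one_of_commute (x := (p : Mult G.n) β) fun m => by
      have := congrFun (congrArg Subtype.val (hcomm (block G.n β m))) β
      rw [mul_block, block_mul, block_apply_same, block_apply_same] at this
      exact this
    have h1 : (p : Mult G.n) β * (p : Mult G.n) β = (p : Mult G.n) β :=
      congrFun (congrArg Subtype.val hpp) β
    have : Nonempty (Fin (G.n β)) := ⟨⟨0, G.n_pos β⟩⟩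
    have h2 : c * c = c := by
      rw [hc, smul_mul_smul_comm, mul_one] at h1
      exact smul_left_injective ℂ (one_ne_zero (α := Matrix (Fin (G.n β)) (Fin (G.n β)) ℂ)) h1
    have h3 : star c = c := by
      have h4 : c * (c - 1) = 0 := by rw [mul_sub, h2, mul_one, sub_self]
      rcases mul_eq_zero.1 h4 with h | h
      · simp [h]
      · simp [sub_eq_zero.1 h]
    rw [hc, star_smul, star_one, h3, smul_mul_smul_comm, mul_one, h2]
  rw [← hstar]
  exact hφ.pos hp0

/-- `φ ∘ S` has density `c ρ⁻¹` in each block, if `φ` has density `ρ`: as `S²` is the modular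
automorphism `ρ · ρ⁻¹`, the density of `φ ∘ S` times `ρ` commutes with the block. -/
lemma IsLeftHaar.exists_dens_comp_antipode [Nonempty I] (hφ : G.IsLeftHaar φ) (α : I) :
    ∃ t : ℝ, 0 < t ∧ dens (φ ∘ₗ hφ.haarData.S) α = ((t ^ 2 : ℝ) : ℂ) • (dens φ α)⁻¹ := by
  set X := hφ.haarData with hX
  set ρ := dens φ α with hρ
  set k := dens (φ ∘ₗ X.S) α with hk
  have h1 : ∀ b, b * k = k * (ρ * b * ρ⁻¹) := by
    intro b
    refine eq_of_trace_mul_eq fun m => ?_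
    have h2 : φ (X.S (block G.n α m * block G.n α b)) =
        φ (X.S (X.σ (block G.n α b) * block G.n α m)) := by
      have h5 : X.S (X.σ (block G.n α b)) = X.σ (X.S (block G.n α b)) := by
        rw [← X.S_S, ← X.S_S]
      rw [X.S_mul, X.S_mul, h5]
      exact X.modular _ _
    have h3 : X.σ (block G.n α b) = block G.n α (ρ * b * ρ⁻¹) := hφ.modularAut_block α b
    rw [h3, block_mul_block, block_mul_block] at h2
    have h4 := apply_block (φ ∘ₗ X.S) α
    simp only [LinearMap.comp_apply, ← hk] at h4
    rw [h4, h4, ← mul_assoc, Matrix.trace_mul_comm, ← mul_assoc, ← mul_assoc] at h2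
    exact h2
  obtain ⟨c, hc⟩ := exists_eq_smul_one_of_commute (x := k * ρ) fun b => by
    rw [← mul_assoc, h1, mul_assoc, mul_assoc, mul_assoc, hφ.inv_mul_dens, mul_one, mul_assoc]
  have hk' : k = c • ρ⁻¹ := by
    rw [← mul_one k, ← hφ.dens_mul_inv α, ← mul_assoc, hc, smul_mul_assoc, one_mul]
  have : Nonempty (Fin (G.n α)) := ⟨⟨0, G.n_pos α⟩⟩
  have hpos : 0 < c * (ρ⁻¹).trace := by
    have h5 := hφ.antipode_block_one_pos α
    have h4 := apply_block (φ ∘ₗ X.S) α 1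
    rw [← hk, hk', mul_one, Matrix.trace_smul, smul_eq_mul] at h4
    rw [← h4]
    exact h5
  have htr : 0 < (ρ⁻¹).trace := (hφ.posDef_dens α).inv.trace_pos
  have hc0 : 0 < c := by
    rw [Complex.eq_re_of_ofReal_le htr.le, Complex.pos_iff] at hpos
    have hr := (Complex.pos_iff.1 htr).1
    simp only [Complex.mul_re, Complex.ofReal_re, Complex.ofReal_im, mul_zero, sub_zero,
      Complex.mul_im, zero_add] at hpos
    refine Complex.pos_iff.2 ⟨pos_of_mul_pos_left hpos.1 hr.le, ?_⟩
    have := hpos.2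
    simp only [zero_eq_mul, hr.ne', or_false] at this
    exact this.symm
  refine ⟨√ c.re, Real.sqrt_pos.2 (Complex.pos_iff.1 hc0).1, ?_⟩
  rw [Real.sq_sqrt (Complex.pos_iff.1 hc0).1.le, hk']
  congr 1
  exact (Complex.eq_re_of_ofReal_le hc0.le)

/-- The positive operator `θ` exists. -/
lemma IsLeftHaar.isModularRoot_theta [Nonempty I] (hφ : G.IsLeftHaar φ) :
    G.IsModularRoot φ (G.theta φ) := by
  refine Classical.epsilon_spec (p := G.IsModularRoot φ) ?_
  choose t ht hk using hφ.exists_dens_comp_antipode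
  refine ⟨fun α => ((t α : ℝ) : ℂ) • (dens φ α)⁻¹, fun α =>
    (hφ.posDef_dens α).inv.smul (by exact_mod_cast ht α), fun a => ?_⟩
  rw [hφ.antipode_eq]
  have h : φ ∘ₗ hφ.haarData.S = φ ∘ₗ sandwichL 1
      ((fun α => ((t α : ℝ) : ℂ) • (dens φ α)⁻¹ : Mult G.n) ^ 2) := functional_ext fun α m => by
    rw [apply_block, hk, LinearMap.comp_apply, sandwichL_apply, sandwich_block, apply_block]
    simp only [Pi.one_apply, one_mul, Pi.pow_apply, pow_two, mul_smul_comm, smul_mul_assoc,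
      Matrix.trace_smul, Complex.ofReal_mul]
    rw [← mul_assoc m, ← mul_assoc (dens φ α), Matrix.trace_mul_comm (_ * _) (_⁻¹),
      ← mul_assoc, ← mul_assoc, hφ.inv_mul_dens, one_mul, Matrix.trace_mul_comm m, smul_smul,
      smul_eq_mul]
  exact LinearMap.congr_fun h a

/-- Each block of `θ` is a positive multiple of the inverse density of `φ`. -/
lemma IsLeftHaar.exists_theta_eq [Nonempty I] (hφ : G.IsLeftHaar φ) (α : I) :
    ∃ t : ℝ, 0 < t ∧ G.theta φ α = ((t : ℝ) : ℂ) • (dens φ α)⁻¹ := by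
  obtain ⟨t, ht, hk⟩ := hφ.exists_dens_comp_antipode α
  refine ⟨t, ht, ?_⟩
  obtain ⟨h1, h2⟩ := hφ.isModularRoot_theta
  refine eq_of_sq_eq_sq (h1 α).posSemidef
    ((hφ.posDef_dens α).inv.smul (α := ℂ) (by exact_mod_cast ht)).posSemidef ?_
  have h3 : dens (φ ∘ₗ hφ.haarData.S) α = G.theta φ α ^ 2 * dens φ α := by
    refine eq_of_trace_mul_eq fun m => ?_
    rw [← apply_block, mul_assoc, Matrix.trace_mul_comm, mul_assoc, LinearMap.comp_apply,
      ← hφ.antipode_eq, h2, sandwich_block, apply_block]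
    simp
  rw [hk] at h3
  have h4 := congrArg (· * (dens φ α)⁻¹) h3
  simp only [mul_assoc, hφ.dens_mul_inv, mul_one, smul_mul_assoc] at h4
  rw [← h4, pow_two (_ • _), smul_mul_smul_comm, pow_two, Complex.ofReal_mul]

end DiscreteQuantumGroup

end DQG
end

/-! ### Slices, and group-likeness of `θ` -/

noncomputable section

namespace DQG

open TensorProduct LinearMap CoveredHopf

section Slices

variable {I : Type*} {n : I → ℕ}

lemma slice_eq_sum {R : Type*} [AddCommMonoid R] [Module ℂ R] {f : A₀ n →ₗ[ℂ] ℂ}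
    {s : Finset I} (hs : ∀ α ∉ s, ∀ m, f (block n α m) = 0)
    (X : ∀ α, Matrix (Fin (n α)) (Fin (n α)) R) :
    slice f X = ∑ α ∈ s, ∑ i, ∑ j, f (matUnit n α i j) • X α i j := by
  refine finsum_eq_sum_of_support_subset _ fun α hα => ?_
  by_contra h
  refine hα (Finset.sum_eq_zero fun i _ => Finset.sum_eq_zero fun j _ => ?_)
  rw [matUnit_eq_block, hs α h, zero_smul]

lemma twist_block_eq_zero (f : A₀ n →ₗ[ℂ] ℂ) (a : A₀ n) :
    ∀ α ∉ supp a, ∀ m, twist f a (block n α m) = 0 := by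
  intro α hα m
  change f (a * _) = 0
  rw [mul_block, apply_eq_zero hα, zero_mul, map_zero, map_zero]

/-- `(id ⊗ f_a)(Y) = f(a Y)` for a multiplier `Y`. -/
lemma slice_twist (f : A₀ n →ₗ[ℂ] ℂ) (a : A₀ n) (Y : Mult n) :
    slice (twist f a) Y = f (sandwich 1 a Y) := by
  rw [slice_eq_sum (twist_block_eq_zero f a)]
  have h : sandwich 1 a Y = ∑ α ∈ supp a, a * block n α (Y α) := by
    rw [← Finset.mul_sum]
    apply Subtype.ext
    funext α
    rw [sandwich_apply, Pi.one_apply, one_mul]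
    change _ = (a : Mult n) α * ((∑ α ∈ supp a, block n α (Y α) : A₀ n) : Mult n) α
    by_cases hα : α ∈ supp a
    · rw [coe_sum, Finset.sum_eq_single_of_mem α hα fun β _ hβ => block_apply_ne hβ.symm _,
        block_apply_same]
    · rw [apply_eq_zero hα, zero_mul, zero_mul]
  rw [h, map_sum]
  refine Finset.sum_congr rfl fun α _ => ?_
  rw [block_eq_sum]
  simp only [Finset.mul_sum, map_sum, mul_smul_comm, map_smul, smul_eq_mul]
  exact Finset.sum_congr rfl fun i _ => Finset.sum_congr rfl fun j _ => mul_comm _ _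

/-- `sandwich` as a linear map in the right multiplier. -/
def sandwichR (a : A₀ n) : Mult n →ₗ[ℂ] A₀ n where
  toFun Y := sandwich 1 a Y
  map_add' Y Z := Subtype.ext (by funext α; simp [sandwich, mul_add])
  map_smul' c Y := Subtype.ext (by funext α; simp [sandwich])

@[simp] lemma sandwichR_apply (a : A₀ n) (Y : Mult n) : sandwichR a Y = sandwich 1 a Y := rfl

/-- The entry `(α, i, j)` of the first leg of `Y`, a multiplier in the second leg. -/
def legEntry (α : I) (i j : Fin (n α)) : Mult₂ n →ₗ[ℂ] Mult n where
  toFun Y β := Matrix.of fun k l => Y α β (i, k) (j, l)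
  map_add' _ _ := rfl
  map_smul' _ _ := rfl

lemma idTensor_twist_apply (g : A₀ n →ₗ[ℂ] ℂ) (b : A₀ n) (z : A₀ n ⊗[ℂ] A₀ n) (α : I)
    (i j : Fin (n α)) : (idTensor (twist g b) z : Mult n) α i j =
      g (sandwich 1 b (legEntry α i j (incl n z))) := by
  induction z with
  | zero =>
    rw [map_zero, map_zero, map_zero, ← sandwichR_apply, map_zero, map_zero]
    rfl
  | tmul p q =>
    have h : legEntry α i j (incl n (p ⊗ₜ q)) = (p : Mult n) α i j • (q : Mult n) := by
      funext β
      ext k l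
      rfl
    have h2 : sandwich 1 b (q : Mult n) = b * q := by
      apply Subtype.ext
      funext β
      simp [sandwich_apply]
    have h3 : idTensor (twist g b) (p ⊗ₜ[ℂ] q) = g (b * q) • p := sliceR_tmul _ _ _
    rw [h, ← sandwichR_apply, map_smul, sandwichR_apply, h2, map_smul, h3, smul_eq_mul, mul_comm]
    rfl
  | add x y hx hy =>
    rw [map_add, map_add, map_add, ← sandwichR_apply, map_add, map_add, sandwichR_apply,
      sandwichR_apply, ← hx, ← hy]
    rfl

/-- `(f_a ⊗ g_b)(Y) = f((id ⊗ g_b)((a ⊗ 1)Y))`. -/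
lemma slice₂_twist (f g : A₀ n →ₗ[ℂ] ℂ) (a b : A₀ n) {Y : Mult₂ n} {z : A₀ n ⊗[ℂ] A₀ n}
    (hz : incl n z = kron n a 1 * Y) :
    slice₂ (twist f a) (twist g b) Y = f (idTensor (twist g b) z) := by
  let y : Mult n := fun α => Matrix.of fun i j => g (sandwich 1 b (legEntry α i j Y))
  have h1 : slice₂ (twist f a) (twist g b) Y = slice (twist f a) y := by
    unfold slice₂
    congr 1
    funext α i j
    exact slice_twist g b (legEntry α i j Y)
  rw [h1, slice_twist]
  congr 1
  apply Subtype.ext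
  funext α
  ext i j
  rw [idTensor_twist_apply, hz, sandwich_apply, Pi.one_apply, one_mul, Matrix.mul_apply]
  have h2 : legEntry α i j (kron n a 1 * Y) =
      ∑ p, (a : Mult n) α i p • legEntry α p j Y := by
    funext β
    ext k l
    rw [Finset.sum_apply, Matrix.sum_apply]
    change ((a : Mult n) α ⊗ₖ (1 : Matrix (Fin (n β)) (Fin (n β)) ℂ) * Y α β) (i, k) (j, l) = _
    rw [Matrix.mul_apply, Fintype.sum_prod_type]
    refine Finset.sum_congr rfl fun p _ => ?_
    rw [Finset.sum_eq_single k (fun q _ hq => by simp [hq.symm]) (by simp)]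
    simp only [Matrix.kroneckerMap_apply, Matrix.one_apply_eq, mul_one]
    rfl
  rw [h2, ← sandwichR_apply, map_sum, map_sum]
  refine Finset.sum_congr rfl fun p _ => ?_
  rw [map_smul, map_smul, smul_eq_mul]
  rfl

end Slices

namespace DiscreteQuantumGroup

variable {I : Type*} {G : DiscreteQuantumGroup I} {φ : A₀ G.n →ₗ[ℂ] ℂ}

lemma convFun_twist (f g : A₀ G.n →ₗ[ℂ] ℂ) (a b x : A₀ G.n) :
    G.convFun (twist f a) (twist g b) x = f (idTensor (twist g b) (G.T₂ (a ⊗ₜ x))) :=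
  slice₂_twist f g a b (G.T₂_tmul a x)

lemma incl_map_sandwichL (d : Mult G.n) (z : A₀ G.n ⊗[ℂ] A₀ G.n) :
    incl G.n (TensorProduct.map (sandwichL d 1) (sandwichL d 1) z) =
      kron G.n d d * incl G.n z := by
  induction z with
  | zero => simp
  | tmul a b => simp [kron_mul_kron, sandwich]
  | add x y hx hy => simp only [map_add, hx, hy, mul_add]

/-- The modular element is group-like, `Δ(θ² r) = (θ² ⊗ θ²)Δ(r)`. -/
lemma IsLeftHaar.Δ_theta_sq [Nonempty I] (hφ : G.IsLeftHaar φ) (r : A₀ G.n) :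
    G.Δ (sandwich (G.theta φ ^ 2) r 1) = kron G.n (G.theta φ ^ 2) (G.theta φ ^ 2) * G.Δ r := by
  set d := G.theta φ ^ 2 with hd
  have hm : ∀ y z, sandwichL d 1 (y * z) = sandwichL d 1 y * z := fun y z => Subtype.ext (by
    simp [sandwich, mul_assoc])
  have hφ' : ∀ y, φ (hφ.haarData.S y) = φ (sandwichL d 1 (hφ.haarData.σ y)) := by
    intro y
    have h : φ ∘ₗ hφ.haarData.S = φ ∘ₗ sandwichL d 1 ∘ₗ hφ.haarData.σ.toLinearMap :=
      functional_ext fun α m => by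
        have h1 : hφ.haarData.σ (block G.n α m) = _ := hφ.modularAut_block α m
        simp only [LinearMap.comp_apply, LinearEquiv.coe_coe, sandwichL_apply]
        rw [h1, ← hφ.antipode_eq, hφ.isModularRoot_theta.2, sandwich_block, sandwich_block,
          apply_block, apply_block, Pi.one_apply, one_mul, mul_one, ← mul_assoc, ← mul_assoc,
          ← mul_assoc, ← mul_assoc, Matrix.trace_mul_comm (_ * _) (_⁻¹), ← mul_assoc,
          ← mul_assoc, ← mul_assoc, hφ.inv_mul_dens, one_mul, Matrix.trace_mul_comm, ← mul_assoc]
    exact LinearMap.congr_fun h y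
  have key : ∀ s : A₀ G.n, G.Δ (sandwich d r 1) * kron G.n 1 s =
      kron G.n d d * G.Δ r * kron G.n 1 s := by
    intro s
    have h := congrArg (incl G.n) (hφ.haarData.T₁_modular hm hφ' r s)
    have h2 : incl G.n (G.T₁ (sandwich d r 1 ⊗ₜ s)) =
      incl G.n (TensorProduct.map (sandwichL d 1) (sandwichL d 1) (G.T₁ (r ⊗ₜ s))) := h
    rw [G.T₁_tmul, incl_map_sandwichL, G.T₁_tmul, ← mul_assoc] at h2
    exact h2
  funext α β
  have h := congrFun (congrFun (key (block G.n β 1)) α) β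
  change _ * kron G.n 1 (block G.n β 1) α β = _ * kron G.n 1 (block G.n β 1) α β at h
  rw [kron_apply, block_apply_same, Pi.one_apply, Matrix.one_kronecker_one, mul_one, mul_one] at h
  exact h

/-- `θ` is group-like: blockwise, `Δ(θ)` and `θ ⊗ θ` are positive square roots of the same
matrix. -/
theorem IsLeftHaar.Δ_theta [Nonempty I] (hφ : G.IsLeftHaar φ) (x : A₀ G.n) :
    G.Δ (sandwich (G.theta φ) x 1) = kron G.n (G.theta φ) (G.theta φ) * G.Δ x := by
  set θ := G.theta φ with hθ
  have hpd : ∀ α, (θ α).PosDef := hφ.isModularRoot_theta.1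
  funext α β
  obtain ⟨t, ht⟩ := G.exists_Δ_unitOn α β
  set e := unitOn G.n t with he
  have he01 : ∀ γ, (e : Mult G.n) γ = 1 ∨ (e : Mult G.n) γ = 0 := fun γ => by
    by_cases h : γ ∈ t
    · exact Or.inl (unitOn_apply h)
    · exact Or.inr (unitOn_apply_eq_zero h)
  have hcentral : ∀ y : Mult G.n, (e : Mult G.n) * y = y * (e : Mult G.n) := fun y => by
    funext γ
    rcases he01 γ with h | h <;> simp [h]
  have hee : (e : Mult G.n) * e = e := by
    funext γ
    rcases he01 γ with h | h <;> simp [h]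
  have hstar : star (e : Mult G.n) = e := by
    funext γ
    rcases he01 γ with h | h <;> simp [h]
  have hsq : G.Δ (sandwich θ e 1) α β = θ α ⊗ₖ θ β := by
    refine eq_of_sq_eq_sq ?_ ((hpd α).posSemidef.kronecker (hpd β).posSemidef) ?_
    · choose B hB using fun γ => exists_eq_star_mul_self (hpd γ).posSemidef
      have h1 : sandwich θ e 1 = star (sandwich B e 1) * sandwich B e 1 := Subtype.ext (by
        change θ * e * 1 = star (B * e * 1) * (B * e * 1)
        have hB' : θ = star B * B := funext hB
        rw [mul_one, mul_one, star_mul, hstar, hB', mul_assoc, ← mul_assoc _ B,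
          mul_assoc (e : Mult G.n), hcentral, mul_assoc, mul_assoc, mul_assoc B, hee])
      rw [h1, map_mul, map_star]
      exact Matrix.posSemidef_conjTranspose_mul_self _
    · have h1 : sandwich θ e 1 * sandwich θ e 1 = sandwich (θ ^ 2) e 1 := Subtype.ext (by
        change θ * e * 1 * (θ * e * 1) = θ ^ 2 * e * 1
        rw [mul_one, mul_one, mul_assoc, ← mul_assoc _ θ, hcentral, mul_assoc, hee, pow_two,
          mul_assoc])
      have h2 := congrFun (congrFun (hφ.Δ_theta_sq e) α) β
      rw [← h1, map_mul] at h2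
      change G.Δ _ α β * G.Δ _ α β = (θ ^ 2) α ⊗ₖ (θ ^ 2) β * G.Δ e α β at h2
      rw [ht, mul_one] at h2
      rw [pow_two, h2, pow_two (_ ⊗ₖ _), ← Matrix.mul_kronecker_mul, ← pow_two, ← pow_two]
      rfl
  have h3 : e * sandwich θ x 1 = sandwich θ e 1 * x := Subtype.ext (by
    change (e : Mult G.n) * (θ * x * 1) = θ * e * 1 * x
    rw [mul_one, mul_one, ← mul_assoc, hcentral])
  have h4 := congrFun (congrFun (congrArg G.Δ h3) α) β
  rw [map_mul, map_mul] at h4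
  change G.Δ e α β * G.Δ _ α β = G.Δ _ α β * G.Δ x α β at h4
  rw [ht, one_mul, hsq] at h4
  exact h4

lemma IsLeftHaar.theta_mul_inv [Nonempty I] (hφ : G.IsLeftHaar φ) :
    G.theta φ * G.thetaInv φ = 1 := funext fun α =>
  Matrix.mul_nonsing_inv _
    ((Matrix.isUnit_iff_isUnit_det _).1 (hφ.isModularRoot_theta.1 α).isUnit)

lemma IsLeftHaar.theta_inv_mul [Nonempty I] (hφ : G.IsLeftHaar φ) :
    G.thetaInv φ * G.theta φ = 1 := funext fun α =>
  Matrix.nonsing_inv_mul _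
    ((Matrix.isUnit_iff_isUnit_det _).1 (hφ.isModularRoot_theta.1 α).isUnit)

lemma IsLeftHaar.Δ_thetaInv [Nonempty I] (hφ : G.IsLeftHaar φ) (x : A₀ G.n) :
    G.Δ (sandwich (G.thetaInv φ) x 1) =
      kron G.n (G.thetaInv φ) (G.thetaInv φ) * G.Δ x := by
  have h := hφ.Δ_theta (sandwich (G.thetaInv φ) x 1)
  have h1 : sandwich (G.theta φ) (sandwich (G.thetaInv φ) x 1) 1 = x := Subtype.ext (by
    change G.theta φ * (G.thetaInv φ * x * 1) * 1 = x
    rw [mul_one, mul_one, ← mul_assoc, hφ.theta_mul_inv, one_mul])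
  rw [h1] at h
  rw [h, ← mul_assoc, kron_mul_kron, hφ.theta_inv_mul]
  have h2 : kron G.n 1 1 = 1 := by
    funext α β
    exact Matrix.one_kronecker_one
  rw [h2, one_mul]

end DiscreteQuantumGroup

end DQG
end

/-! ### The action on the representation space -/

noncomputable section

namespace DQG

open TensorProduct LinearMap CoveredHopf

section Slices

variable {I : Type*} {n : I → ℕ} {R : Type*} [AddCommMonoid R] [Module ℂ R]

/-- The positions of the matrix entries in the blocks of the finite set `s`. -/
def entries (n : I → ℕ) (s : Finset I) : Finset (Σ α, Fin (n α) × Fin (n α)) :=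
  s.sigma fun _ => Finset.univ

lemma slice_eq_sum_entries {f : A₀ n →ₗ[ℂ] ℂ} {s : Finset I}
    (hs : ∀ α ∉ s, ∀ m, f (block n α m) = 0) (X : ∀ α, Matrix (Fin (n α)) (Fin (n α)) R) :
    slice f X = ∑ q ∈ entries n s,
      f (matUnit n q.1 q.2.1 q.2.2) • X q.1 q.2.1 q.2.2 := by
  rw [slice_eq_sum hs, entries, Finset.sum_sigma]
  exact Finset.sum_congr rfl fun α _ => (Fintype.sum_prod_type
    fun q : Fin (n α) × Fin (n α) => f (matUnit n α q.1 q.2) • X α q.1 q.2).symm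

lemma twist_block_eq_zero_of_subset (f : A₀ n →ₗ[ℂ] ℂ) {a : A₀ n} {s : Finset I}
    (hs : supp a ⊆ s) : ∀ α ∉ s, ∀ m, twist f a (block n α m) = 0 := fun α hα =>
  twist_block_eq_zero f a α fun h => hα (hs h)

lemma slice_twist_add (f : A₀ n →ₗ[ℂ] ℂ) (a b : A₀ n)
    (X : ∀ α, Matrix (Fin (n α)) (Fin (n α)) R) :
    slice (twist f (a + b)) X = slice (twist f a) X + slice (twist f b) X := by
  classical
  let s := supp a ∪ supp b ∪ supp (a + b)
  rw [slice_eq_sum_entries (twist_block_eq_zero_of_subset f (s := s) (by grind)),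
    slice_eq_sum_entries (twist_block_eq_zero_of_subset f (s := s) (by grind)),
    slice_eq_sum_entries (twist_block_eq_zero_of_subset f (s := s) (by grind)),
    ← Finset.sum_add_distrib]
  refine Finset.sum_congr rfl fun q _ => ?_
  rw [← add_smul]
  simp [twist, add_mul]

lemma slice_twist_smul (f : A₀ n →ₗ[ℂ] ℂ) (c : ℂ) (a : A₀ n)
    (X : ∀ α, Matrix (Fin (n α)) (Fin (n α)) R) :
    slice (twist f (c • a)) X = c • slice (twist f a) X := by
  classical
  let s := supp a ∪ supp (c • a)
  rw [slice_eq_sum_entries (twist_block_eq_zero_of_subset f (s := s) (by grind)),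
    slice_eq_sum_entries (twist_block_eq_zero_of_subset f (s := s) (by grind)), Finset.smul_sum]
  refine Finset.sum_congr rfl fun q _ => ?_
  rw [smul_smul]
  simp [twist, smul_mul_assoc]

end Slices

namespace DiscreteQuantumGroup

variable {I : Type*} {G : DiscreteQuantumGroup I} {φ : A₀ G.n →ₗ[ℂ] ℂ}

lemma exists_finset_Δ_block_eq_zero (G : DiscreteQuantumGroup I) (α β : I) :
    ∃ t : Finset I, ∀ γ ∉ t, ∀ m, G.Δ (block G.n γ m) α β = 0 := by
  obtain ⟨t, ht⟩ := G.exists_Δ_unitOn α β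
  refine ⟨t, fun γ hγ m => ?_⟩
  have h : unitOn G.n t * block G.n γ m = 0 := by
    rw [mul_block, unitOn_apply_eq_zero hγ, zero_mul, map_zero]
  have h1 := congrFun (congrFun (congrArg G.Δ h) α) β
  rw [map_mul, map_zero] at h1
  change G.Δ _ α β * G.Δ _ α β = 0 at h1
  rwa [ht, one_mul] at h1

variable {H : Type*} [NormedAddCommGroup H] [InnerProductSpace ℂ H] [CompleteSpace H]

/-- A representation turns convolution of functionals of finite support into composition. -/
lemma UnitaryRep.slice_mul_slice (U : G.UnitaryRep H) {f g k : A₀ G.n →ₗ[ℂ] ℂ}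
    {s t r : Finset I} (hf : ∀ α ∉ s, ∀ m, f (block G.n α m) = 0)
    (hg : ∀ α ∉ t, ∀ m, g (block G.n α m) = 0) (hk : ∀ α ∉ r, ∀ m, k (block G.n α m) = 0)
    (h : ∀ x, k x = G.convFun f g x) : slice f U.U * slice g U.U = slice k U.U := by
  classical
  choose v hv using exists_finset_Δ_block_eq_zero G
  -- a finite set of blocks that supports `k` and all `Δ(·)_{αβ}` with `α ∈ s`, `β ∈ t`
  let w := r ∪ s.biUnion fun α => t.biUnion fun β => v α β
  have hkw : ∀ α ∉ w, ∀ m, k (block G.n α m) = 0 := fun α hα =>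
    hk α fun h => hα (Finset.mem_union_left _ h)
  have hU : ∀ α ∈ s, ∀ β ∈ t, ∀ i j p q, U.U α i j * U.U β p q =
      ∑ c ∈ entries G.n w,
        G.Δ (matUnit G.n c.1 c.2.1 c.2.2) α β (i, p) (j, q) • U.U c.1 c.2.1 c.2.2 := by
    intro α hα β hβ i j p q
    have h1 := congrFun (congrFun (U.comul α β) (i, p)) (j, q)
    rw [Matrix.kroneckerMap_apply] at h1
    rw [← h1, entries, Finset.sum_sigma]
    simp only [idComul, Fintype.sum_prod_type]
    refine finsum_eq_sum_of_support_subset _ fun γ hγ => ?_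
    by_contra hγw
    refine hγ (Finset.sum_eq_zero fun a _ => Finset.sum_eq_zero fun b _ => ?_)
    rw [matUnit_eq_block, hv α β γ fun h' => hγw (Finset.mem_union_right _
      (Finset.mem_biUnion.2 ⟨α, hα, Finset.mem_biUnion.2 ⟨β, hβ, h'⟩⟩))]
    simp
  have hkc : ∀ x, k x = ∑ a ∈ entries G.n s, ∑ b ∈ entries G.n t,
      f (matUnit G.n a.1 a.2.1 a.2.2) * g (matUnit G.n b.1 b.2.1 b.2.2) *
        G.Δ x a.1 b.1 (a.2.1, b.2.1) (a.2.2, b.2.2) := by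
    intro x
    have h1 : k x = slice f fun α => Matrix.of fun i j => slice g (legEntry α i j (G.Δ x)) := h x
    rw [h1, slice_eq_sum_entries hf]
    refine Finset.sum_congr rfl fun a _ => ?_
    rw [Matrix.of_apply, slice_eq_sum_entries hg, Finset.smul_sum]
    exact Finset.sum_congr rfl fun b _ => by
      rw [smul_eq_mul, smul_eq_mul, mul_assoc]
      rfl
  rw [slice_eq_sum_entries hf, slice_eq_sum_entries hg, slice_eq_sum_entries hkw,
    Finset.sum_mul_sum]
  simp only [hkc, Finset.sum_smul]
  conv_rhs => rw [Finset.sum_comm]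
  refine Finset.sum_congr rfl fun a ha => ?_
  conv_rhs => rw [Finset.sum_comm]
  refine Finset.sum_congr rfl fun b hb => ?_
  rw [smul_mul_smul_comm, hU _ (Finset.mem_sigma.1 ha).1 _ (Finset.mem_sigma.1 hb).1,
    Finset.smul_sum]
  exact Finset.sum_congr rfl fun c _ => by rw [smul_smul]

lemma IsLeftHaar.psi_eq [Nonempty I] (hφ : G.IsLeftHaar φ) :
    G.psi φ = φ ∘ₗ hφ.haarData.S := by
  ext a
  rw [LinearMap.comp_apply, ← hφ.antipode_eq, hφ.isModularRoot_theta.2]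
  rfl

/-- `ψ_{θ⁻¹ S(a) θ⁻²}(x) = φ(S⁻¹(a) θ⁻¹ x)`, with `a = S(y)`. -/
lemma IsLeftHaar.twist_psi_eq [Nonempty I] (hφ : G.IsLeftHaar φ) (y : A₀ G.n) :
    twist (G.psi φ) (sandwich (G.thetaInv φ) (G.antipode (G.antipode y)) (G.thetaInv φ ^ 2)) =
      twist φ (sandwich 1 y (G.thetaInv φ)) := by
  refine functional_ext fun α m => ?_
  obtain ⟨t, ht, hθ⟩ := hφ.exists_theta_eq α
  have ht' : (t : ℂ) ≠ 0 := by exact_mod_cast ht.ne'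
  have hinv : G.thetaInv φ α = (t : ℂ)⁻¹ • dens φ α := by
    refine Matrix.inv_eq_right_inv ?_
    rw [hθ, smul_mul_smul_comm, hφ.inv_mul_dens, mul_inv_cancel₀ ht', one_smul]
  have hσ : ((G.antipode (G.antipode y) : A₀ G.n) : Mult G.n) α =
      dens φ α * (y : Mult G.n) α * (dens φ α)⁻¹ := by
    rw [hφ.antipode_eq, hφ.haarData.S_S]
    rfl
  change φ (sandwich 1 (_ * _) _) = φ (_ * _)
  rw [mul_block, mul_block, sandwich_block, apply_block, apply_block, sandwich_apply,
    sandwich_apply, hσ, Pi.pow_apply, Pi.pow_apply, Pi.one_apply, one_mul, one_mul, hinv, hθ]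
  set ρ := dens φ α
  set b := (y : Mult G.n) α
  simp only [pow_two, mul_smul_comm, smul_mul_assoc, Matrix.trace_smul, smul_smul]
  have h1 : ∀ x, ρ⁻¹ * (ρ * x) = x := fun x => by rw [← mul_assoc, hφ.inv_mul_dens, one_mul]
  have h2 : ρ * (ρ * (ρ * b * ρ⁻¹) * (ρ * ρ) * m * (ρ⁻¹ * ρ⁻¹)) =
      ρ * (ρ * (ρ * (b * (ρ * m)))) * (ρ⁻¹ * ρ⁻¹) := by
    simp only [mul_assoc, h1]
  rw [h2, Matrix.trace_mul_comm]
  simp only [mul_assoc, h1]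
  congr 1
  field_simp

/-- The functionals `ψ_{θ⁻¹ S(a) θ⁻²}` convolve in the opposite order of the product of the
convolution algebra. -/
lemma IsLeftHaar.convFun_act [Nonempty I] (hφ : G.IsLeftHaar φ) (a b x : A₀ G.n) :
    twist (G.psi φ) (sandwich (G.thetaInv φ) (G.antipode (G.conv φ a b)) (G.thetaInv φ ^ 2)) x =
      G.convFun
        (twist (G.psi φ) (sandwich (G.thetaInv φ) (G.antipode b) (G.thetaInv φ ^ 2)))
        (twist (G.psi φ) (sandwich (G.thetaInv φ) (G.antipode a) (G.thetaInv φ ^ 2))) x := by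
  have hsurj : Function.Surjective G.antipode := by
    rw [hφ.antipode_eq]
    exact hφ.haarData.S_surjective
  obtain ⟨a, rfl⟩ := hsurj a
  obtain ⟨b, rfl⟩ := hsurj b
  obtain ⟨y, hy⟩ := hsurj (G.conv φ (G.antipode a) (G.antipode b))
  rw [← hy, hφ.twist_psi_eq, hφ.twist_psi_eq, hφ.twist_psi_eq, convFun_twist]
  set d := G.thetaInv φ with hd
  have hmul : ∀ p z : A₀ G.n, sandwich 1 p d * z = p * sandwich d z 1 := fun p z =>
    Subtype.ext (by
      change 1 * (p : Mult G.n) * d * z = p * (d * z * 1)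
      rw [one_mul, mul_one, mul_assoc])
  have h1 : ∀ z, idTensor (twist φ (sandwich 1 a d)) z =
      idTensor (twist φ a) ((sandwichL d 1).lTensor (A₀ G.n) z) := by
    intro z
    refine (congrArg (fun f => sliceR f z) ?_).trans (sliceR_lTensor _ _ _).symm
    ext z
    exact congrArg φ (hmul a z)
  have h2 : (sandwichL d 1).lTensor (A₀ G.n) (G.T₂ (sandwich 1 b d ⊗ₜ x)) =
      G.T₂ (b ⊗ₜ sandwich d x 1) := by
    apply incl_injective
    have h3 : ∀ z, incl G.n ((sandwichL d 1).lTensor (A₀ G.n) z) = kron G.n 1 d * incl G.n z := by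
      intro z
      induction z with
      | zero => simp
      | tmul p q => simp [kron_mul_kron, sandwich]
      | add p q hp hq => simp only [map_add, hp, hq, mul_add]
    rw [h3, G.T₂_tmul, G.T₂_tmul, hφ.Δ_thetaInv, ← hd, ← mul_assoc, ← mul_assoc,
      kron_mul_kron, kron_mul_kron, mul_one, one_mul, one_mul]
    have h4 : (sandwich 1 b d : Mult G.n) = b * d := one_mul (b : Mult G.n) ▸ rfl
    rw [h4]
  rw [h1, h2]
  refine (congrArg φ (hmul y x)).trans ?_
  refine hφ.haarData.φ_conv_mul a b _ y ?_
  rw [← hφ.antipode_eq, hy]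
  rfl

lemma IsLeftHaar.twist_psi_conv [Nonempty I] (hφ : G.IsLeftHaar φ) (a b x : A₀ G.n) :
    twist (G.psi φ) (G.conv φ a b) x =
      G.convFun (twist (G.psi φ) a) (twist (G.psi φ) b) x := by
  rw [convFun_twist, hφ.psi_eq, conv, hφ.antipode_eq]
  exact hφ.haarData.ψ_conv_mul a b x

lemma IsLeftHaar.act_act [Nonempty I] (hφ : G.IsLeftHaar φ) (U : G.UnitaryRep H) (ξ : H)
    (a b : A₀ G.n) : act φ U (act φ U ξ a) b = act φ U ξ (G.conv φ a b) := by
  unfold act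
  rw [← mul_apply_eq_comp, U.slice_mul_slice (twist_block_eq_zero _ _)
    (twist_block_eq_zero _ _) (twist_block_eq_zero _ _) (hφ.convFun_act a b)]

lemma act_add (φ : A₀ G.n →ₗ[ℂ] ℂ) (U : G.UnitaryRep H) (ξ : H) (a b : A₀ G.n) :
    act φ U ξ (a + b) = act φ U ξ a + act φ U ξ b := by
  unfold act
  rw [map_add, ← sandwichL_apply, map_add, slice_twist_add]
  rfl

lemma act_smul (φ : A₀ G.n →ₗ[ℂ] ℂ) (U : G.UnitaryRep H) (ξ : H) (c : ℂ) (a : A₀ G.n) :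
    act φ U ξ (c • a) = c • act φ U ξ a := by
  unfold act
  rw [map_smul, ← sandwichL_apply, map_smul, slice_twist_smul]
  rfl

variable {C : Type*} [NonUnitalCStarAlgebra C] {𝒞 : G.Action C} {U : G.UnitaryRep H}
  {π : C →⋆ₙₐ[ℂ] (H →L[ℂ] H)}

/-- `U_{ij} π(c) = ∑ₖ π(Δ_C(c)_{ik}) U_{kj}`. -/
lemma IsCovariant.U_mul_π (hπ : IsCovariant 𝒞 U π) (c : C) (α : I) (i j : Fin (G.n α)) :
    U.U α i j * π c = ∑ k, π (𝒞.ΔC c α i k) * U.U α k j := by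
  have h : (𝒞.ΔC c α).map π * U.U α = U.U α * Matrix.diagonal fun _ => π c := by
    rw [hπ.covariant, mul_assoc, Unitary.star_mul_self_of_mem (U.unitary_mem α), mul_one]
  have h1 := congrFun (congrFun h i) j
  rw [Matrix.mul_apply, Matrix.mul_diagonal] at h1
  exact h1.symm

lemma IsCovariant.act_mem (hπ : IsCovariant 𝒞 U π) {D : Set C}
    (hD : ∀ c ∈ D, ∀ α i j, 𝒞.ΔC c α i j ∈ D) {ξ : H} (hξ : ξ ∈ spanImage π D) (a : A₀ G.n) :
    act φ U ξ a ∈ spanImage π D := by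
  have hU : ∀ α i j, U.U α i j ξ ∈ spanImage π D := by
    intro α i j
    induction hξ using Submodule.span_induction with
    | zero => simp
    | mem ξ hξ =>
      obtain ⟨c, hc, η, rfl⟩ := hξ
      rw [← mul_apply_eq_comp, hπ.U_mul_π, _root_.sum_apply]
      exact Submodule.sum_mem _ fun k _ => Submodule.subset_span ⟨_, hD c hc α i k, _, rfl⟩
    | add x y _ _ hx hy => rw [map_add]; exact Submodule.add_mem _ hx hy
    | smul z x _ hx => rw [map_smul]; exact Submodule.smul_mem _ z hx
  unfold act
  rw [slice_eq_sum_entries (twist_block_eq_zero _ _), _root_.sum_apply]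
  exact Submodule.sum_mem _ fun q _ => Submodule.smul_mem _ _ (hU _ _ _)

lemma IsLeftHaar.isRightModuleAction (hφ : G.IsLeftHaar φ) (hπ : IsCovariant 𝒞 U π) {D : Set C}
    (hD : ∀ c ∈ D, ∀ α i j, 𝒞.ΔC c α i j ∈ D) :
    IsRightModuleAction (G.conv φ) (spanImage π D) (act φ U) where
  mem _ hξ a := hπ.act_mem hD hξ a
  add_left _ _ _ _ _ := map_add _ _ _
  smul_left _ _ _ _ := map_smul _ _ _
  add_right ξ _ a b := act_add φ U ξ a b
  smul_right z ξ _ a := act_smul φ U ξ z a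
  act_act ξ _ a b := by
    cases isEmpty_or_nonempty I with
    | inl h => simp [act, slice, finsum_of_isEmpty]
    | inr h => exact hφ.act_act U ξ a b

end DiscreteQuantumGroup

end DQG

end

theorem mainTheorem5 {I : Type*} (G : DQG.DiscreteQuantumGroup I)
    (φ : DQG.A₀ G.n →ₗ[ℂ] ℂ) (hφ : G.IsLeftHaar φ)
    {C : Type*} [NonUnitalCStarAlgebra C] (𝒞 : G.Action C)
    {H : Type*} [NormedAddCommGroup H] [InnerProductSpace ℂ H] [CompleteSpace H]
    (U : G.UnitaryRep H) (π : C →⋆ₙₐ[ℂ] (H →L[ℂ] H))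
    (hπ : DQG.DiscreteQuantumGroup.IsCovariant 𝒞 U π) :
    (∀ a b x, DQG.twist (G.psi φ) (G.conv φ a b) x =
      G.convFun (DQG.twist (G.psi φ) a) (DQG.twist (G.psi φ) b) x) ∧
    DQG.IsRightModuleAction (G.conv φ) (DQG.spanImage π Set.univ)
      (DQG.DiscreteQuantumGroup.act φ U) ∧
    DQG.IsRightModuleAction (G.conv φ) (DQG.spanImage π (𝒞.C₀ : Set C))
      (DQG.DiscreteQuantumGroup.act φ U) := by
  refine ⟨fun a b x => ?_, hφ.isRightModuleAction hπ fun _ _ _ _ _ => Set.mem_univ _,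
    hφ.isRightModuleAction hπ fun c hc => 𝒞.entry_mem c hc⟩
  cases isEmpty_or_nonempty I with
  | inl h =>
    have hx : x = 0 := Subtype.ext (funext fun α => h.elim α)
    simp [hx, DQG.DiscreteQuantumGroup.convFun, DQG.slice₂, DQG.slice]
  | inr h => exact hφ.twist_psi_conv a b x
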